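/- Let $m\ge 1$, let $f:\mathbb R\to\mathbb R$ and $\gamma_{ij}:\mathbb R\to\mathbb R$ ($i,j\in\{1,\dots,m\}$, $i\neq j$) be locally Lipschitz, and put $F(s)=\int_0^s f(\sigma)\,d\sigma$. Assume: (L1) $f$ is even. (L2) There is $s_0>0$ with $F(s_0)=0$, $F<0$ on $(0,s_0)$, and $F$ positive, nondecreasing and unbounded on $(s_0,\infty)$. (G1) $\gamma_{ij}(0)=0$ and $s\,\gamma_{ij}(s)\ge 0$ for all $s\in\mathbb R$ and $i\ne j$. (G2) For each $i\neq j$, either $\gamma_{ij}\equiv 0$, or there is a continuous, strictly increasing $\alpha:\mathbb R_{\ge0}\to\mathbb R_{\ge 0}$ with $\alpha(0)=0$ and $|\gamma_{ij}(s)|\ge\alpha(|s|)$ for all $s\in\mathbb R$. (Connectedness) The directed graph on $\{1,\dots,m\}$ with an edge $(i,j)$ iff $i\ne j$ and $\gamma_{ij}\not\equiv 0$ has a node to which there is a directed path from every other node. For $v\in\mathbb R^2$ let $e_\varphi=(-\sin\varphi,\cos\varphi)^T$, $h_\varphi=(\cos\varphi,\sin\varphi)^T$, $$\bar f(v)=\frac1{2\pi}\int_0^{2\pi}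 f(h_\varphi^Tv)\,(e_\varphi^Tv)\,e_\varphi\,d\varphi,\qquad \bar\gamma_{ij}(v)=\frac1{2\pi}\int_0^{2\pi}\gamma_{ij}(e_\varphi^Tv)\,e_\varphi\,d\varphi,$$ and consider the averaged Liénard array in $\mathbb R^{2m}$ $$\dot\eta_i=-\bar f(\eta_i)+\sum_{j\ne i}\bar\gamma_{ij}(\eta_j-\eta_i),\qquad i=1,\dots,m. \tag{1}$$ For $s>0$ let $\kappa(s)=\frac2\pi\int_0^s f(\sigma)\sqrt{1-\sigma^2/s^2}\,d\sigma$. Theorem. There is exactly one $\rho>0$ with $\kappa(\rho)=0$. For this $\rho$ put $\mathcal R=\{\eta\in\mathbb R^{2m}:\eta_i=\eta_j\text{ and }|\eta_i|=\rho\text{ for all }i,j\}$, and write $|\eta|_{\mathcal R}$ for the Euclidean distance from $\eta$ to $\mathcal R$. Then $\mathcal R$ is locally asymptotically stable for (1), that is: - for every $\varepsilon>0$ there is $\delta>0$ such that every solution of (1) on $[0,\infty)$ with $|\eta(0)|_{\mathcal R}\le\delta$ satisfies $|\eta(t)|_{\mathcal R}\le\varepsilon$ for all $t\ge0$; - there is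 $\delta>0$ such that for every initial state with $|\eta(0)|_{\mathcal R}\le\delta$ a solution of (1) exists on $[0,\infty)$, and every such solution satisfies $|\eta(t)|_{\mathcal R}\to0$ as $t\to\infty$. Moreover, for every initial state with $0\notin\mathrm{co}\{\eta_1(0),\dots,\eta_m(0)\}$ (where $\mathrm{co}$ denotes the convex hull) a solution of (1) exists on $[0,\infty)$, and for every such solution there is $\eta^*\in\mathcal R$ with $\eta(t)\to\eta^*$ as $t\to\infty$. -/

import Mathlib

open Set Filter Topology MeasureTheory
open scoped NNReal

/-- The plane with its Euclidean norm: the state space of a single oscillator. -/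
abbrev Plane : Type := EuclideanSpace ℝ (Fin 2)

/-- The space `ℝ^{2m}` of the stacked states `η = (η₁, …, ηₘ)`, with its Euclidean norm. -/
abbrev ArrayState (m : ℕ) : Type := PiLp 2 (fun _ : Fin m => Plane)

/-- Class-`K` functions. -/
def IsClassK (α : ℝ≥0 → ℝ≥0) : Prop :=
  Continuous α ∧ α 0 = 0 ∧ StrictMono α

/-- `{γ i j : i ≠ j}` is an interconnection (conditions (G1) and (G2)).
The diagonal entries `γ i i` play no role. -/
def IsInterconnection {m : ℕ} (γ : Fin m → Fin m → ℝ → ℝ) : Prop :=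
  ∀ i j : Fin m, i ≠ j →
    (γ i j 0 = 0 ∧ ∀ s : ℝ, 0 ≤ s * γ i j s) ∧
    ((∀ s : ℝ, γ i j s = 0) ∨
      ∃ α : ℝ≥0 → ℝ≥0, IsClassK α ∧ ∀ s : ℝ, (α ‖s‖₊ : ℝ) ≤ |γ i j s|)

/-- The edges of the graph of an interconnection: `(i, j)` is an edge iff `γ i j` is not
identically zero. -/
def InterconnectionEdge {m : ℕ} (γ : Fin m → Fin m → ℝ → ℝ) (i j : Fin m) : Prop :=
  i ≠ j ∧ ∃ s : ℝ, γ i j s ≠ 0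

/-- The graph of the interconnection has a node to which there is a directed path from every
other node. In particular the set of nodes is nonempty. -/
def InterconnectionConnected {m : ℕ} (γ : Fin m → Fin m → ℝ → ℝ) : Prop :=
  ∃ l : Fin m, ∀ k : Fin m, k ≠ l → Relation.TransGen (InterconnectionEdge γ) k l

/-- The function `F(s) = ∫₀ˢ f` satisfies condition (L2). -/
def LienardL2 (F : ℝ → ℝ) : Prop :=
  ∃ s₀ : ℝ, 0 < s₀ ∧ F s₀ = 0 ∧ (∀ s ∈ Ioo 0 s₀, F s < 0) ∧
    (∀ s ∈ Ioi s₀, 0 < F s) ∧ MonotoneOn F (Ioi s₀) ∧ ¬ BddAbove (F '' Ioi s₀)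

noncomputable section

/-- The time average `f̄ : ℝ² → ℝ²` of the damping term. -/
def avgDamping (f : ℝ → ℝ) (v : Plane) : Plane :=
  (1 / (2 * Real.pi)) • ∫ φ in (0 : ℝ)..(2 * Real.pi),
    (f (Real.cos φ * v 0 + Real.sin φ * v 1) * (-Real.sin φ * v 0 + Real.cos φ * v 1)) •
      (!₂[-Real.sin φ, Real.cos φ] : Plane)

/-- The time average `γ̄ : ℝ² → ℝ²` of a coupling function `g : ℝ → ℝ`. -/
def avgCoupling (g : ℝ → ℝ) (v : Plane) : Plane :=
  (1 / (2 * Real.pi)) • ∫ φ in (0 : ℝ)..(2 * Real.pi),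
    g (-Real.sin φ * v 0 + Real.cos φ * v 1) • (!₂[-Real.sin φ, Real.cos φ] : Plane)

/-- The right-hand side of the average array
`η̇ᵢ = -f̄(ηᵢ) + ∑_{j ≠ i} γ̄ᵢⱼ(ηⱼ - ηᵢ)`. -/
def avgArray {m : ℕ} (f : ℝ → ℝ) (γ : Fin m → Fin m → ℝ → ℝ) (η : ArrayState m) :
    ArrayState m :=
  WithLp.toLp 2 fun i =>
    -avgDamping f (η i) + ∑ j ∈ Finset.univ.erase i, avgCoupling (γ i j) (η j - η i)

/-- `κ(s) = (2/π) ∫₀ˢ f(σ) √(1 - σ²/s²) dσ` (used for `s ≥ 0` only). -/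
def lienardKappa (f : ℝ → ℝ) (s : ℝ) : ℝ :=
  (2 / Real.pi) * ∫ σ in (0 : ℝ)..s, f σ * Real.sqrt (1 - σ ^ 2 / s ^ 2)

end

/-- The synchronization set: all `ηᵢ` are equal and have norm `ρ`. -/
def syncSet (m : ℕ) (ρ : ℝ) : Set (ArrayState m) :=
  {η | (∀ i j : Fin m, η i = η j) ∧ ∀ i : Fin m, ‖η i‖ = ρ}

/-- `x` is a solution of `ẋ = X(x)` on `[0, ∞)` with `x(0) = x₀`. -/
def IsForwardSolution {E : Type*} [NormedAddCommGroup E] [NormedSpace ℝ E]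
    (X : E → E) (x₀ : E) (x : ℝ → E) : Prop :=
  x 0 = x₀ ∧ IsIntegralCurveOn x (fun _ => X) (Ici 0)

/-- The set `S` is stable for `ẋ = X(x)`. -/
def IsStableSet {E : Type*} [NormedAddCommGroup E] [NormedSpace ℝ E]
    (X : E → E) (S : Set E) : Prop :=
  ∀ ε > 0, ∃ δ > 0, ∀ x₀ : E, Metric.infDist x₀ S ≤ δ →
    ∀ x : ℝ → E, IsForwardSolution X x₀ x → ∀ t ≥ 0, Metric.infDist (x t) S ≤ ε

/-- The set `S` is locally attractive for `ẋ = X(x)`: from every point near `S` there starts a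
solution on `[0, ∞)`, and every such solution approaches `S`. -/
def IsLocallyAttractiveSet {E : Type*} [NormedAddCommGroup E] [NormedSpace ℝ E]
    (X : E → E) (S : Set E) : Prop :=
  ∃ δ > 0, ∀ x₀ : E, Metric.infDist x₀ S ≤ δ →
    (∃ x : ℝ → E, IsForwardSolution X x₀ x) ∧
    ∀ x : ℝ → E, IsForwardSolution X x₀ x →
      Tendsto (fun t => Metric.infDist (x t) S) atTop (𝓝 0)

/-- The set `S` is locally asymptotically stable for `ẋ = X(x)`. -/
def IsLocallyAsymptoticallyStableSet {E : Type*} [NormedAddCommGroup E] [NormedSpace ℝ E]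
    (X : E → E) (S : Set E) : Prop :=
  IsStableSet X S ∧ IsLocallyAttractiveSet X S

/-! Averaging makes every term radial: `f̄(v) = a(v) v` with `a(v) = κ(‖v‖)/‖v‖` for `v ≠ 0`, and
`γ̄ᵢⱼ(v) = bᵢⱼ(v) v` with `bᵢⱼ ≥ 0`, strictly positive off the origin along edges (`dampingGain_eq`,
`avgCoupling_eq_smul`). Since `κ` is negative before its unique zero `ρ` and positive after it,
damping pulls every nonzero state radially towards the circle of radius `ρ`. The dynamics is then
studied for any field with these sign properties (`IsRadialArray`).

The basic observation is a maximum principle: at an agent where a linear functional `φ` is largest,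
no coupling can increase `φ`, so only the radial damping matters. Hence half-planes bounded by lines
through the origin are invariant, and so are sectors cut off near the origin
(`family_le_of_deriv_le`, `sector_invariant`).

Convergence is read off the cluster points of the trajectory. If `ψ` attains its asymptotic upper
bound at a cluster point, its derivative along the field there is nonnegative
(`le_apply_of_mapClusterPt`). Applied to the extreme slopes of the agents, this transports
extremality along edges to the root node of the graph. The root has both the largest and the
smallest slope, so all agents at all cluster points lie on one fixed ray (`exists_slope`). Applied
to the extreme radii on that ray, it forces radius `ρ`. The cluster point is therefore unique and
the bounded trajectory converges (`exists_tendsto`). -/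

/-! ### The sign change of `κ`. -/

theorem hasDerivAt_primitive {f : ℝ → ℝ} (hf : Continuous f) (s : ℝ) :
    HasDerivAt (fun x => ∫ σ in (0 : ℝ)..x, f σ) (f s) s :=
  (hf.integral_hasStrictDerivAt 0 s).hasDerivAt

theorem lienardKappa_eq_trig {f : ℝ → ℝ} (hf : Continuous f) {s : ℝ} (hs : 0 < s) :
    lienardKappa f s =
      (2 / Real.pi) * ∫ θ in (0 : ℝ)..(Real.pi / 2),
        f (s * Real.sin θ) * Real.cos θ * (s * Real.cos θ) := by
  have h := intervalIntegral.integral_comp_mul_deriv (a := 0) (b := Real.pi / 2)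
    (f := fun θ => s * Real.sin θ) (f' := fun θ => s * Real.cos θ)
    (g := fun σ => f σ * Real.sqrt (1 - σ ^ 2 / s ^ 2))
    (fun θ _ => (Real.hasDerivAt_sin θ).const_mul s) (by fun_prop) (by fun_prop)
  simp only [Real.sin_zero, mul_zero, Real.sin_pi_div_two, mul_one] at h
  rw [lienardKappa, ← h]
  congr 1
  refine intervalIntegral.integral_congr fun θ hθ => ?_
  rw [uIcc_of_le (by positivity)] at hθ
  have hc : 0 ≤ Real.cos θ :=
    Real.cos_nonneg_of_mem_Icc ⟨by linarith [hθ.1, Real.pi_pos], hθ.2⟩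
  have : 1 - (s * Real.sin θ) ^ 2 / s ^ 2 = Real.cos θ ^ 2 := by
    field_simp
    linarith [Real.sin_sq_add_cos_sq θ]
  simp only [Function.comp_apply, this, Real.sqrt_sq hc]

/-- Integration by parts in the angle; the boundary terms vanish because `F 0 = 0` and `cos (π/2) =
0`. The sign of `F` then controls the sign of `κ`. -/
theorem lienardKappa_eq_integral_primitive {f : ℝ → ℝ} (hf : Continuous f) {s : ℝ} (hs : 0 < s) :
    lienardKappa f s =
      (2 / Real.pi) * ∫ θ in (0 : ℝ)..(Real.pi / 2),
        (∫ σ in (0 : ℝ)..(s * Real.sin θ), f σ) * Real.sin θ := by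
  have hF (θ : ℝ) : HasDerivAt (fun θ => ∫ σ in (0 : ℝ)..(s * Real.sin θ), f σ)
      (f (s * Real.sin θ) * (s * Real.cos θ)) θ :=
    HasDerivAt.comp (h₂ := fun x => ∫ σ in (0 : ℝ)..x, f σ) θ (hasDerivAt_primitive hf _)
      ((Real.hasDerivAt_sin θ).const_mul s)
  have h := intervalIntegral.integral_mul_deriv_eq_deriv_mul (a := 0) (b := Real.pi / 2)
    (fun θ _ => hF θ) (fun θ _ => Real.hasDerivAt_cos θ)
    (Continuous.intervalIntegrable (by fun_prop) _ _)
    (Continuous.intervalIntegrable (by fun_prop) _ _)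
  simp only [Real.cos_pi_div_two, Real.sin_zero, mul_zero, intervalIntegral.integral_same,
    zero_mul, sub_zero, zero_sub, mul_neg, intervalIntegral.integral_neg, neg_inj] at h
  rw [lienardKappa_eq_trig hf hs, h]
  congr 1
  refine intervalIntegral.integral_congr fun θ _ => ?_
  ring

theorem continuousOn_lienardKappa {f : ℝ → ℝ} (hf : Continuous f) :
    ContinuousOn (lienardKappa f) (Ioi 0) := by
  have h : Continuous fun s : ℝ => (2 / Real.pi) * ∫ θ in (0 : ℝ)..(Real.pi / 2),
        f (s * Real.sin θ) * Real.cos θ * (s * Real.cos θ) :=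
    (intervalIntegral.continuous_parametric_intervalIntegral_of_continuous'
      (by fun_prop) _ _).const_mul _
  exact h.continuousOn.congr fun s hs => lienardKappa_eq_trig hf hs

theorem lienardKappa_neg {f : ℝ → ℝ} (hf : Continuous f) {s₀ s : ℝ} (hs : 0 < s) (hs₀ : s ≤ s₀)
    (hF : ∀ s ∈ Ioo 0 s₀, ∫ σ in (0 : ℝ)..s, f σ < 0) : lienardKappa f s < 0 := by
  rw [lienardKappa_eq_integral_primitive hf hs]
  refine mul_neg_of_pos_of_neg (by positivity) ?_
  rw [← neg_pos, ← intervalIntegral.integral_neg]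
  have hFc : Continuous fun x => ∫ σ in (0 : ℝ)..x, f σ :=
    continuous_iff_continuousAt.2 fun x => (hasDerivAt_primitive hf x).continuousAt
  refine intervalIntegral.intervalIntegral_pos_of_pos_on
    (Continuous.intervalIntegrable (by fun_prop) _ _) (fun θ hθ => ?_) (by positivity)
  have h0 : 0 < Real.sin θ := Real.sin_pos_of_pos_of_lt_pi hθ.1 (by linarith [hθ.2, Real.pi_pos])
  have h1 : Real.sin θ < 1 := by
    rw [← Real.sin_pi_div_two]
    exact Real.sin_lt_sin_of_lt_of_le_pi_div_two (by linarith [hθ.1, Real.pi_pos]) le_rfl hθ.2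
  have := hF (s * Real.sin θ) ⟨by positivity, by nlinarith⟩
  nlinarith

/-- The factor `s` does not affect the sign, and it turns the weight into one that increases with
`s` at each fixed `σ`. -/
theorem mul_lienardKappa {f : ℝ → ℝ} {s : ℝ} (hs : 0 < s) :
    s * lienardKappa f s =
      (2 / Real.pi) * ∫ σ in (0 : ℝ)..s, f σ * Real.sqrt (s ^ 2 - σ ^ 2) := by
  rw [lienardKappa, mul_left_comm, ← intervalIntegral.integral_const_mul]
  congr 1
  refine intervalIntegral.integral_congr fun σ _ => ?_
  have : s ^ 2 - σ ^ 2 = s ^ 2 * (1 - σ ^ 2 / s ^ 2) := by field_simp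
  simp only [this, Real.sqrt_mul (sq_nonneg s), Real.sqrt_sq hs.le]
  ring

theorem nonneg_of_monotoneOn_primitive {f : ℝ → ℝ} (hf : Continuous f) {s₀ s : ℝ} (hs : s₀ < s)
    (hF : MonotoneOn (fun s => ∫ σ in (0 : ℝ)..s, f σ) (Ioi s₀)) : 0 ≤ f s := by
  have h := hF.derivWithin_nonneg (x := s)
  rwa [derivWithin_of_isOpen isOpen_Ioi hs, (hasDerivAt_primitive hf s).deriv] at h

/-- Beyond `s₀` a larger weight meets `f ≥ 0`. On `[0, s₀]`, integration by parts moves the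
derivative onto the weight difference, which is increasing in `σ`, and pairs it with `F < 0`; the
boundary terms vanish since `F 0 = F s₀ = 0`. -/
theorem integral_mul_sqrt_lt {f : ℝ → ℝ} (hf : Continuous f) {s₀ s s' : ℝ} (hs₀ : 0 < s₀)
    (hs : s₀ < s) (hss' : s < s') (hF0 : ∫ σ in (0 : ℝ)..s₀, f σ = 0)
    (hFneg : ∀ s ∈ Ioo 0 s₀, ∫ σ in (0 : ℝ)..s, f σ < 0) (hfnn : ∀ s, s₀ < s → 0 ≤ f s) :
    ∫ σ in (0 : ℝ)..s, f σ * Real.sqrt (s ^ 2 - σ ^ 2) <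
      ∫ σ in (0 : ℝ)..s', f σ * Real.sqrt (s' ^ 2 - σ ^ 2) := by
  have hint (r a b : ℝ) :
      IntervalIntegrable (fun σ => f σ * Real.sqrt (r ^ 2 - σ ^ 2)) volume a b :=
    Continuous.intervalIntegrable (by fun_prop) _ _
  -- `Real.sqrt` is `0` on negative arguments, so both integrals can be taken over `[0, s']`.
  have htail : ∫ σ in s..s', f σ * Real.sqrt (s ^ 2 - σ ^ 2) = 0 := by
    rw [intervalIntegral.integral_congr (g := fun _ => 0), intervalIntegral.integral_zero]
    intro σ hσ
    rw [uIcc_of_le hss'.le] at hσ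
    simp only
    rw [Real.sqrt_eq_zero_of_nonpos (by nlinarith [hσ.1]), mul_zero]
  have hext : ∫ σ in (0 : ℝ)..s, f σ * Real.sqrt (s ^ 2 - σ ^ 2) =
      ∫ σ in (0 : ℝ)..s', f σ * Real.sqrt (s ^ 2 - σ ^ 2) := by
    rw [← intervalIntegral.integral_add_adjacent_intervals (hint s 0 s) (hint s s s'), htail,
      add_zero]
  rw [← sub_pos, hext, ← intervalIntegral.integral_sub (hint _ _ _) (hint _ _ _),
    ← intervalIntegral.integral_add_adjacent_intervals (b := s₀)
      ((hint _ _ _).sub (hint _ _ _)) ((hint _ _ _).sub (hint _ _ _))]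
  refine add_pos_of_pos_of_nonneg ?_ (intervalIntegral.integral_nonneg (by linarith) ?_)
  · have hd (r : ℝ) (hr : s₀ < r) (σ : ℝ) (hσ : σ ∈ uIcc 0 s₀) :
        HasDerivAt (fun σ => Real.sqrt (r ^ 2 - σ ^ 2)) (-(σ / Real.sqrt (r ^ 2 - σ ^ 2))) σ := by
      rw [uIcc_of_le hs₀.le] at hσ
      have hpos : 0 < r ^ 2 - σ ^ 2 := by nlinarith [hσ.1, hσ.2]
      convert! ((hasDerivAt_pow 2 σ).const_sub (r ^ 2)).sqrt hpos.ne' using 1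
      have := (Real.sqrt_pos.2 hpos).ne'
      field_simp
      ring
    have hcont (r : ℝ) (hr : s₀ < r) :
        ContinuousOn (fun σ => -(σ / Real.sqrt (r ^ 2 - σ ^ 2))) (uIcc 0 s₀) := by
      refine (ContinuousOn.div (by fun_prop) (by fun_prop) fun σ hσ => ?_).neg
      rw [uIcc_of_le hs₀.le] at hσ
      exact (Real.sqrt_pos.2 (by nlinarith [hσ.1, hσ.2])).ne'
    have hv : ContinuousOn (fun σ => -(σ / Real.sqrt (s' ^ 2 - σ ^ 2)) -
        -(σ / Real.sqrt (s ^ 2 - σ ^ 2))) (uIcc 0 s₀) :=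
      (hcont s' (hs.trans hss')).sub (hcont s hs)
    have h := intervalIntegral.integral_mul_deriv_eq_deriv_mul
      (fun σ _ => hasDerivAt_primitive hf σ)
      (fun σ hσ => (hd s' (hs.trans hss') σ hσ).sub (hd s hs σ hσ))
      (hf.intervalIntegrable _ _) hv.intervalIntegrable
    simp only [hF0, intervalIntegral.integral_same, zero_mul, sub_zero, zero_sub,
      Pi.sub_apply] at h
    have h' : ∫ σ in (0 : ℝ)..s₀, (f σ * Real.sqrt (s' ^ 2 - σ ^ 2) -
        f σ * Real.sqrt (s ^ 2 - σ ^ 2)) =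
        ∫ σ in (0 : ℝ)..s₀, -((∫ τ in (0 : ℝ)..σ, f τ) * (-(σ / Real.sqrt (s' ^ 2 - σ ^ 2)) -
        -(σ / Real.sqrt (s ^ 2 - σ ^ 2)))) := by
      rw [intervalIntegral.integral_neg, h, neg_neg]
      exact intervalIntegral.integral_congr fun σ _ => by ring
    have hFc : Continuous fun x => ∫ σ in (0 : ℝ)..x, f σ :=
      continuous_iff_continuousAt.2 fun x => (hasDerivAt_primitive hf x).continuousAt
    rw [h']
    refine intervalIntegral.intervalIntegral_pos_of_pos_on
      (hFc.continuousOn.mul hv).neg.intervalIntegrable (fun σ hσ => ?_) hs₀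
    have h1 : Real.sqrt (s ^ 2 - σ ^ 2) < Real.sqrt (s' ^ 2 - σ ^ 2) :=
      Real.sqrt_lt_sqrt (by nlinarith [hσ.1, hσ.2]) (by nlinarith [hσ.1, hσ.2])
    have h2 : 0 < Real.sqrt (s ^ 2 - σ ^ 2) := Real.sqrt_pos.2 (by nlinarith [hσ.1, hσ.2])
    have h3 : σ / Real.sqrt (s' ^ 2 - σ ^ 2) < σ / Real.sqrt (s ^ 2 - σ ^ 2) :=
      div_lt_div_of_pos_left hσ.1 h2 h1
    nlinarith [hFneg σ hσ]
  · intro σ hσ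
    rcases hσ.1.eq_or_lt with rfl | h
    · have hle : Real.sqrt (s ^ 2 - s₀ ^ 2) ≤ Real.sqrt (s' ^ 2 - s₀ ^ 2) :=
        Real.sqrt_le_sqrt (by nlinarith)
      have h0 : 0 ≤ f s₀ := by
        refine ge_of_tendsto (hf.continuousAt.tendsto.mono_left (nhdsWithin_le_nhds (s := Ioi s₀))) ?_
        filter_upwards [self_mem_nhdsWithin] with x hx using hfnn x hx
      nlinarith
    · have hle : Real.sqrt (s ^ 2 - σ ^ 2) ≤ Real.sqrt (s' ^ 2 - σ ^ 2) :=
        Real.sqrt_le_sqrt (by nlinarith)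
      nlinarith [hfnn σ h]

/-- With `τ = 1/s → 0` the weight on `[0, S]` tends to `1`, so that part of the integral tends to `F
S > 0`; the part beyond `S` is nonnegative. -/
theorem exists_lienardKappa_pos {f : ℝ → ℝ} (hf : Continuous f) {s₀ S : ℝ} (hs₀ : 0 < s₀)
    (hS : s₀ < S) (hFS : 0 < ∫ σ in (0 : ℝ)..S, f σ) (hfnn : ∀ s, s₀ < s → 0 ≤ f s) :
    ∃ s, s₀ < s ∧ 0 < lienardKappa f s := by
  have hcont : Continuous fun τ : ℝ => ∫ σ in (0 : ℝ)..S, f σ * Real.sqrt (1 - σ ^ 2 * τ ^ 2) :=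
    intervalIntegral.continuous_parametric_intervalIntegral_of_continuous' (by fun_prop) _ _
  have h0 : ∀ᶠ τ in 𝓝[>] (0 : ℝ),
      0 < ∫ σ in (0 : ℝ)..S, f σ * Real.sqrt (1 - σ ^ 2 * τ ^ 2) :=
    (hcont.continuousAt.tendsto.mono_left nhdsWithin_le_nhds).eventually
      (lt_mem_nhds (by simpa using hFS))
  have h1 : ∀ᶠ τ in 𝓝[>] (0 : ℝ), τ < S⁻¹ :=
    nhdsWithin_le_nhds (gt_mem_nhds (inv_pos.2 (hs₀.trans hS)))
  obtain ⟨τ, hτ, hτS, hτ0⟩ := (h0.and (h1.and self_mem_nhdsWithin)).exists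
  have hτ0 : 0 < τ := hτ0
  have hSτ : S < τ⁻¹ := by
    rw [lt_inv_comm₀ (hs₀.trans hS) hτ0]
    exact hτS
  refine ⟨τ⁻¹, hS.trans hSτ, ?_⟩
  rw [lienardKappa, ← intervalIntegral.integral_add_adjacent_intervals (b := S)
    (Continuous.intervalIntegrable (by fun_prop) _ _)
    (Continuous.intervalIntegrable (by fun_prop) _ _)]
  refine mul_pos (by positivity) (add_pos_of_pos_of_nonneg ?_ ?_)
  · simpa [div_eq_mul_inv] using hτ
  · refine intervalIntegral.integral_nonneg hSτ.le fun σ hσ => ?_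
    exact mul_nonneg (hfnn σ (hS.trans_le hσ.1)) (Real.sqrt_nonneg _)

theorem exists_sign_change_lienardKappa {f : ℝ → ℝ} (hf : Continuous f)
    (hL2 : LienardL2 (fun s => ∫ σ in (0 : ℝ)..s, f σ)) :
    ∃ ρ, 0 < ρ ∧ lienardKappa f ρ = 0 ∧ (∀ s ∈ Ioo 0 ρ, lienardKappa f s < 0) ∧
      ∀ s ∈ Ioi ρ, 0 < lienardKappa f s := by
  obtain ⟨s₀, hs₀, hF0, hFneg, hFpos, hFmono, -⟩ := hL2
  have hfnn (s : ℝ) (hs : s₀ < s) : 0 ≤ f s := nonneg_of_monotoneOn_primitive hf hs hFmono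
  obtain ⟨S, hS, hκS⟩ := exists_lienardKappa_pos hf hs₀ (lt_add_one s₀)
    (hFpos _ (lt_add_one s₀)) hfnn
  have hκ0 : lienardKappa f s₀ < 0 := lienardKappa_neg hf hs₀ le_rfl hFneg
  obtain ⟨ρ, hρ, hκρ⟩ := intermediate_value_Ioo hS.le
    ((continuousOn_lienardKappa hf).mono fun x hx => hs₀.trans_le hx.1) ⟨hκ0, hκS⟩
  have hρ0 : 0 < ρ := hs₀.trans hρ.1
  have hmono {s s' : ℝ} (hs : s₀ < s) (hss' : s < s') :
      s * lienardKappa f s < s' * lienardKappa f s' := by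
    rw [mul_lienardKappa (hs₀.trans hs), mul_lienardKappa (hs₀.trans (hs.trans hss'))]
    exact mul_lt_mul_of_pos_left (integral_mul_sqrt_lt hf hs₀ hs hss' hF0 hFneg hfnn)
      (by positivity)
  refine ⟨ρ, hρ0, hκρ, fun s hs => ?_, fun s hs => ?_⟩
  · rcases le_or_gt s s₀ with h | h
    · exact lienardKappa_neg hf hs.1 h hFneg
    · have := hmono h hs.2
      rw [hκρ, mul_zero] at this
      exact (pos_iff_neg_of_mul_neg this).1 hs.1
  · have := hmono hρ.1 hs
    rw [hκρ, mul_zero] at this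
    exact (pos_iff_pos_of_mul_pos this).1 (hρ0.trans hs)

/-! ### The averaged terms as scalar multiples of their argument. -/

theorem Plane.norm_sq (v : Plane) : ‖v‖ ^ 2 = v 0 ^ 2 + v 1 ^ 2 := by
  simp [EuclideanSpace.norm_sq_eq, Fin.sum_univ_two]

theorem Plane.norm_sq_pos {v : Plane} (hv : v ≠ 0) : 0 < v 0 ^ 2 + v 1 ^ 2 := by
  rw [← Plane.norm_sq]
  exact pow_pos (norm_pos_iff.2 hv) 2

theorem Plane.eq_smul_of_cross_eq_zero {v w : Plane} (hv : v ≠ 0)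
    (h : w 0 * v 1 - w 1 * v 0 = 0) :
    w = ((w 0 * v 0 + w 1 * v 1) / ‖v‖ ^ 2) • v := by
  have hpos := Plane.norm_sq_pos hv
  rw [Plane.norm_sq]
  ext i
  fin_cases i
  · simp only [Fin.zero_eta, PiLp.smul_apply, smul_eq_mul]
    field_simp
    linear_combination v 1 * h
  · simp only [Fin.mk_one, PiLp.smul_apply, smul_eq_mul]
    field_simp
    linear_combination - v 0 * h

theorem integral_smul_tangent {Φ : ℝ → ℝ} (hΦ : Continuous Φ) (a b : ℝ) :
    ∫ φ in a..b, Φ φ • (!₂[-Real.sin φ, Real.cos φ] : Plane) =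
      !₂[∫ φ in a..b, Φ φ * -Real.sin φ, ∫ φ in a..b, Φ φ * Real.cos φ] := by
  have hc : Continuous fun φ => Φ φ • (!₂[-Real.sin φ, Real.cos φ] : Plane) := by fun_prop
  ext i
  have h := (PiLp.proj 2 (𝕜 := ℝ) (fun _ : Fin 2 => ℝ) i).intervalIntegral_comp_comm
    (hc.intervalIntegrable (μ := volume) a b)
  rw [PiLp.proj_apply] at h
  rw [← h]
  fin_cases i <;> simp

theorem hasDerivAt_radial (v : Plane) (φ : ℝ) :
    HasDerivAt (fun φ => Real.cos φ * v 0 + Real.sin φ * v 1)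
      (-Real.sin φ * v 0 + Real.cos φ * v 1) φ :=
  ((Real.hasDerivAt_cos φ).mul_const _).add ((Real.hasDerivAt_sin φ).mul_const _)

theorem hasDerivAt_tangential (v : Plane) (φ : ℝ) :
    HasDerivAt (fun φ => -Real.sin φ * v 0 + Real.cos φ * v 1)
      (-Real.cos φ * v 0 + -Real.sin φ * v 1) φ :=
  ((Real.hasDerivAt_sin φ).neg.mul_const _).add ((Real.hasDerivAt_cos φ).mul_const _)

theorem avgCoupling_coord {g : ℝ → ℝ} (hg : Continuous g) (v w : Plane) :
    avgCoupling g v 0 * w 0 + avgCoupling g v 1 * w 1 =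
      (1 / (2 * Real.pi)) * ∫ φ in (0 : ℝ)..(2 * Real.pi),
        g (-Real.sin φ * v 0 + Real.cos φ * v 1) * (-Real.sin φ * w 0 + Real.cos φ * w 1) := by
  rw [avgCoupling, integral_smul_tangent (by fun_prop)]
  simp only [PiLp.smul_apply, smul_eq_mul, Matrix.cons_val_zero,
    Matrix.cons_val_one]
  rw [mul_assoc, mul_assoc, ← mul_add, ← intervalIntegral.integral_mul_const,
    ← intervalIntegral.integral_mul_const, ← intervalIntegral.integral_add
    (Continuous.intervalIntegrable (by fun_prop) _ _)
    (Continuous.intervalIntegrable (by fun_prop) _ _)]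
  congr 1
  exact intervalIntegral.integral_congr fun φ _ => by ring

theorem avgDamping_coord {f : ℝ → ℝ} (hf : Continuous f) (v w : Plane) :
    avgDamping f v 0 * w 0 + avgDamping f v 1 * w 1 =
      (1 / (2 * Real.pi)) * ∫ φ in (0 : ℝ)..(2 * Real.pi),
        f (Real.cos φ * v 0 + Real.sin φ * v 1) * (-Real.sin φ * v 0 + Real.cos φ * v 1) *
          (-Real.sin φ * w 0 + Real.cos φ * w 1) := by
  rw [avgDamping, integral_smul_tangent (by fun_prop)]
  simp only [PiLp.smul_apply, smul_eq_mul, Matrix.cons_val_zero,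
    Matrix.cons_val_one]
  rw [mul_assoc, mul_assoc, ← mul_add, ← intervalIntegral.integral_mul_const,
    ← intervalIntegral.integral_mul_const, ← intervalIntegral.integral_add
    (Continuous.intervalIntegrable (by fun_prop) _ _)
    (Continuous.intervalIntegrable (by fun_prop) _ _)]
  congr 1
  exact intervalIntegral.integral_congr fun φ _ => by ring

noncomputable section

/-- The coefficient `b` with `avgCoupling g v = b • v`. -/
def couplingGain (g : ℝ → ℝ) (v : Plane) : ℝ :=
  (avgCoupling g v 0 * v 0 + avgCoupling g v 1 * v 1) / ‖v‖ ^ 2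

/-- The coefficient `a` with `avgDamping f v = a • v`. -/
def dampingGain (f : ℝ → ℝ) (v : Plane) : ℝ :=
  (avgDamping f v 0 * v 0 + avgDamping f v 1 * v 1) / ‖v‖ ^ 2

end

/-- The component orthogonal to `v` vanishes: with `E φ = e_φᵀ v` its integrand is `g(E) E'`, an
exact derivative over a full period. -/
theorem avgCoupling_eq_smul {g : ℝ → ℝ} (hg : Continuous g) (hg0 : g 0 = 0) (v : Plane) :
    avgCoupling g v = couplingGain g v • v := by
  rcases eq_or_ne v 0 with rfl | hv
  · simp [avgCoupling, hg0]
  refine Plane.eq_smul_of_cross_eq_zero hv ?_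
  have h := avgCoupling_coord hg v !₂[v 1, -v 0]
  have h' := intervalIntegral.integral_comp_mul_deriv (a := 0) (b := 2 * Real.pi)
    (fun φ _ => hasDerivAt_tangential v φ) (by fun_prop) hg
  simp only [Real.sin_zero, Real.cos_zero, Real.sin_two_pi, Real.cos_two_pi,
    intervalIntegral.integral_same, Function.comp_apply] at h'
  simp only [Matrix.cons_val_zero, Matrix.cons_val_one] at h
  rw [show avgCoupling g v 0 * v 1 - avgCoupling g v 1 * v 0 =
    avgCoupling g v 0 * v 1 + avgCoupling g v 1 * -v 0 by ring, h]
  rw [intervalIntegral.integral_congr (g := fun φ => g (-Real.sin φ * v 0 + Real.cos φ * v 1) *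
    (-Real.cos φ * v 0 + -Real.sin φ * v 1)) fun φ _ => by ring, h', mul_zero]

/-- With `H φ = h_φᵀ v` one has `H' = e_φᵀ v`, and the orthogonal component has integrand `-f(H) H
H'`, again exact over a period. -/
theorem avgDamping_eq_smul {f : ℝ → ℝ} (hf : Continuous f) (v : Plane) :
    avgDamping f v = dampingGain f v • v := by
  rcases eq_or_ne v 0 with rfl | hv
  · simp [avgDamping]
  refine Plane.eq_smul_of_cross_eq_zero hv ?_
  have h := avgDamping_coord hf v !₂[v 1, -v 0]
  have h' := intervalIntegral.integral_comp_mul_deriv (a := 0) (b := 2 * Real.pi)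
    (g := fun s => f s * s) (fun φ _ => hasDerivAt_radial v φ) (by fun_prop) (by fun_prop)
  simp only [Real.sin_zero, Real.cos_zero, Real.sin_two_pi, Real.cos_two_pi,
    intervalIntegral.integral_same, Function.comp_apply] at h'
  simp only [Matrix.cons_val_zero, Matrix.cons_val_one] at h
  rw [show avgDamping f v 0 * v 1 - avgDamping f v 1 * v 0 =
    avgDamping f v 0 * v 1 + avgDamping f v 1 * -v 0 by ring, h]
  rw [intervalIntegral.integral_congr (g := fun φ => -(f (Real.cos φ * v 0 + Real.sin φ * v 1) *
    (Real.cos φ * v 0 + Real.sin φ * v 1) * (-Real.sin φ * v 0 + Real.cos φ * v 1)))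
    fun φ _ => by ring, intervalIntegral.integral_neg, h', neg_zero, mul_zero]

theorem couplingGain_nonneg {g : ℝ → ℝ} (hg : Continuous g) (hs : ∀ s, 0 ≤ s * g s) (v : Plane) :
    0 ≤ couplingGain g v := by
  rw [couplingGain, avgCoupling_coord hg]
  refine div_nonneg (mul_nonneg (by positivity)
    (intervalIntegral.integral_nonneg (by positivity) fun φ _ => ?_)) (sq_nonneg _)
  rw [mul_comm]
  exact hs _

theorem couplingGain_pos {g : ℝ → ℝ} (hg : Continuous g) (hs : ∀ s, s ≠ 0 → 0 < s * g s)
    {v : Plane} (hv : v ≠ 0) : 0 < couplingGain g v := by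
  rw [couplingGain, avgCoupling_coord hg]
  refine div_pos (mul_pos (by positivity) ?_) (pow_pos (norm_pos_iff.2 hv) 2)
  refine intervalIntegral.integral_pos (by positivity) (by fun_prop) (fun φ _ => ?_) ?_
  · rw [mul_comm]
    rcases eq_or_ne (-Real.sin φ * v 0 + Real.cos φ * v 1) 0 with h | h
    · rw [h, zero_mul]
    · exact (hs _ h).le
  -- One angle with `e_φᵀ v ≠ 0` suffices by continuity: `φ = 0` sees `v 1` and `φ = π/2` sees `-v
  -- 0`.
  · by_cases h1 : v 1 = 0
    · have h0 : v 0 ≠ 0 := fun h0 => by simpa [h0, h1] using Plane.norm_sq_pos hv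
      refine ⟨Real.pi / 2, ⟨by positivity, by linarith [Real.pi_pos]⟩, ?_⟩
      rw [mul_comm]
      exact hs _ (by simpa using h0)
    · refine ⟨0, ⟨le_rfl, by positivity⟩, ?_⟩
      rw [mul_comm]
      exact hs _ (by simpa using h1)

theorem exists_neg_le_dampingGain {f : ℝ → ℝ} (hf : Continuous f) (R : ℝ) :
    ∃ C, 0 ≤ C ∧ ∀ v : Plane, ‖v‖ ≤ R → -C ≤ dampingGain f v := by
  obtain ⟨C, hC⟩ := isCompact_Icc.exists_bound_of_continuousOn (s := Icc (-R) R) hf.continuousOn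
  refine ⟨max C 0, le_max_right _ _, fun v hv => ?_⟩
  rcases eq_or_ne v 0 with rfl | hv0
  · simp [dampingGain]
  have hpos : 0 < ‖v‖ ^ 2 := pow_pos (norm_pos_iff.2 hv0) 2
  have hR : 0 ≤ R := (norm_nonneg v).trans hv
  rw [dampingGain, le_div_iff₀ hpos, avgDamping_coord hf]
  have hle : ∫ φ in (0 : ℝ)..(2 * Real.pi), (-max C 0 * ‖v‖ ^ 2 : ℝ) ≤
      ∫ φ in (0 : ℝ)..(2 * Real.pi),
        f (Real.cos φ * v 0 + Real.sin φ * v 1) * (-Real.sin φ * v 0 + Real.cos φ * v 1) *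
          (-Real.sin φ * v 0 + Real.cos φ * v 1) := by
    refine intervalIntegral.integral_mono_on (by positivity)
      (Continuous.intervalIntegrable (by fun_prop) _ _)
      (Continuous.intervalIntegrable (by fun_prop) _ _) fun φ _ => ?_
    have hsum : (Real.cos φ * v 0 + Real.sin φ * v 1) ^ 2 +
        (-Real.sin φ * v 0 + Real.cos φ * v 1) ^ 2 = ‖v‖ ^ 2 := by
      rw [Plane.norm_sq]
      linear_combination (v 0 ^ 2 + v 1 ^ 2) * Real.sin_sq_add_cos_sq φ
    set H := Real.cos φ * v 0 + Real.sin φ * v 1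
    set E := -Real.sin φ * v 0 + Real.cos φ * v 1
    have hH : H ∈ Icc (-R) R := abs_le.1 (abs_le_of_sq_le_sq (by nlinarith [norm_nonneg v]) hR)
    have hfH : -max C 0 ≤ f H := by
      have := (abs_le.1 (hC H hH)).1
      linarith [le_max_left C 0]
    nlinarith [le_max_right C 0, sq_nonneg E, sq_nonneg H, mul_nonneg (le_max_right C 0) (sq_nonneg H)]
  rw [intervalIntegral.integral_const, sub_zero, smul_eq_mul] at hle
  calc -max C 0 * ‖v‖ ^ 2 =
        (1 / (2 * Real.pi)) * ((2 * Real.pi) * (-max C 0 * ‖v‖ ^ 2)) := by field_simp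
    _ ≤ _ := mul_le_mul_of_nonneg_left hle (by positivity)

theorem integral_eq_four_mul_of_symm {G : ℝ → ℝ} (hG : Continuous G)
    (hper : Function.Periodic G Real.pi) (hsymm : ∀ x, G (Real.pi - x) = G x) :
    ∫ x in (0 : ℝ)..(2 * Real.pi), G x = 4 * ∫ x in (0 : ℝ)..(Real.pi / 2), G x := by
  have h1 := hper.intervalIntegral_add_eq Real.pi 0
  have h2 := intervalIntegral.integral_comp_sub_left G (a := 0) (b := Real.pi / 2) Real.pi
  simp only [hsymm] at h2
  rw [show Real.pi - Real.pi / 2 = Real.pi / 2 by ring, sub_zero] at h2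
  rw [← intervalIntegral.integral_add_adjacent_intervals (b := Real.pi)
    (hG.intervalIntegrable _ _) (hG.intervalIntegrable _ _), two_mul, h1, zero_add,
    ← intervalIntegral.integral_add_adjacent_intervals (a := 0) (b := Real.pi / 2) (c := Real.pi)
    (hG.intervalIntegrable _ _) (hG.intervalIntegrable _ _), ← h2]
  ring

theorem Plane.exists_polar (v : Plane) :
    ∃ θ : ℝ, v 0 = ‖v‖ * Real.cos θ ∧ v 1 = ‖v‖ * Real.sin θ := by
  have hn : ‖(⟨v 0, v 1⟩ : ℂ)‖ = ‖v‖ := by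
    rw [← sq_eq_sq₀ (norm_nonneg _) (norm_nonneg _), Plane.norm_sq, Complex.sq_norm,
      Complex.normSq_mk]
    ring
  refine ⟨Complex.arg ⟨v 0, v 1⟩, ?_, ?_⟩
  · rw [← hn, Complex.norm_mul_cos_arg]
  · rw [← hn, Complex.norm_mul_sin_arg]

/-- In polar form the integrand is a translate of `f (r cos x) (r sin x)²`. Evenness of `f` reduces
the full period to a quarter, where `x ↦ π/2 - x` produces `κ`. -/
theorem dampingGain_eq {f : ℝ → ℝ} (hf : Continuous f) (heven : Function.Even f)
    {v : Plane} (hv : v ≠ 0) : dampingGain f v = lienardKappa f ‖v‖ / ‖v‖ := by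
  have hr : 0 < ‖v‖ := norm_pos_iff.2 hv
  obtain ⟨θ, h0, h1⟩ := Plane.exists_polar v
  rw [dampingGain, avgDamping_coord hf, lienardKappa_eq_trig hf hr]
  set r := ‖v‖
  set G : ℝ → ℝ := fun x => f (r * Real.cos x) * (r * Real.sin x) ^ 2 with hGdef
  have hG : Continuous G := by fun_prop
  have hper : Function.Periodic G Real.pi := fun x => by
    simp only [hGdef, Real.cos_add_pi, Real.sin_add_pi, mul_neg, heven _, neg_sq]
  have hsymm (x : ℝ) : G (Real.pi - x) = G x := by
    simp only [hGdef, Real.cos_pi_sub, Real.sin_pi_sub, mul_neg, heven _]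
  have hint : ∫ φ in (0 : ℝ)..(2 * Real.pi),
        f (Real.cos φ * v 0 + Real.sin φ * v 1) * (-Real.sin φ * v 0 + Real.cos φ * v 1) *
          (-Real.sin φ * v 0 + Real.cos φ * v 1) = ∫ φ in (0 : ℝ)..(2 * Real.pi), G (φ - θ) := by
    refine intervalIntegral.integral_congr fun φ _ => ?_
    simp only [hGdef, h0, h1, Real.cos_sub, Real.sin_sub]
    rw [show Real.cos φ * (r * Real.cos θ) + Real.sin φ * (r * Real.sin θ) =
      r * (Real.cos φ * Real.cos θ + Real.sin φ * Real.sin θ) by ring]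
    ring
  have hshift : ∫ x in (0 - θ)..(2 * Real.pi - θ), G x = ∫ x in (0 : ℝ)..(2 * Real.pi), G x := by
    have := (hper.nat_mul 2).intervalIntegral_add_eq (0 - θ) 0
    rw [zero_add] at this
    push_cast at this
    rw [← this]
    congr 1
    ring
  have hcomp := intervalIntegral.integral_comp_sub_left G (a := 0) (b := Real.pi / 2) (Real.pi / 2)
  rw [sub_self, sub_zero] at hcomp
  rw [hint, intervalIntegral.integral_comp_sub_right, hshift,
    integral_eq_four_mul_of_symm hG hper hsymm, ← hcomp]
  have hlast : ∫ x in (0 : ℝ)..(Real.pi / 2), G (Real.pi / 2 - x) =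
      r * ∫ x in (0 : ℝ)..(Real.pi / 2),
        f (r * Real.sin x) * Real.cos x * (r * Real.cos x) := by
    rw [← intervalIntegral.integral_const_mul]
    refine intervalIntegral.integral_congr fun x _ => ?_
    simp only [hGdef, Real.cos_pi_div_two_sub, Real.sin_pi_div_two_sub]
    ring
  rw [hlast]
  field_simp
  ring

/-! ### Local Lipschitz continuity of the averaged field. -/

theorem LocallyLipschitz.intervalIntegral {E F : Type*} [NormedAddCommGroup E] [ProperSpace E]
    [NormedAddCommGroup F] [NormedSpace ℝ F] {Φ : ℝ × E → F} (hΦ : LocallyLipschitz Φ) (a b : ℝ) :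
    LocallyLipschitz fun v => ∫ φ in a..b, Φ (φ, v) := by
  intro v
  obtain ⟨K, hK⟩ := hΦ.locallyLipschitzOn.exists_lipschitzOnWith_of_compact
    ((isCompact_uIcc (a := a) (b := b)).prod (isCompact_closedBall v 1))
  have hc := hΦ.continuous
  refine ⟨K * ‖b - a‖₊, Metric.closedBall v 1, Metric.closedBall_mem_nhds v one_pos,
    LipschitzOnWith.of_dist_le_mul fun x hx y hy => ?_⟩
  rw [dist_eq_norm, ← intervalIntegral.integral_sub
    (Continuous.intervalIntegrable (by fun_prop) _ _)
    (Continuous.intervalIntegrable (by fun_prop) _ _)]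
  calc _ ≤ K * dist x y * |b - a| := by
        refine intervalIntegral.norm_integral_le_of_norm_le_const fun φ hφ => ?_
        have hφ' := uIoc_subset_uIcc hφ
        have := hK.dist_le_mul (φ, x) ⟨hφ', hx⟩ (φ, y) ⟨hφ', hy⟩
        rwa [dist_prod_same_left, dist_eq_norm (Φ _)] at this
    _ = _ := by
        simp only [NNReal.coe_mul, coe_nnnorm, Real.norm_eq_abs]
        ring

theorem LocallyLipschitz.smul_fun {E F : Type*} [MetricSpace E] [NormedAddCommGroup F]
    [NormedSpace ℝ F] {c : E → ℝ} {g : E → F} (hc : LocallyLipschitz c) (hg : LocallyLipschitz g) :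
    LocallyLipschitz fun x => c x • g x := by
  have h : LocallyLipschitz fun p : ℝ × F => p.1 • p.2 :=
    ContDiff.locallyLipschitz (𝕂 := ℝ) contDiff_smul
  exact h.comp (hc.prodMk hg)

theorem LocallyLipschitz.finset_sum {ι E F : Type*} [MetricSpace E] [NormedAddCommGroup F]
    (s : Finset ι) {g : ι → E → F} (hg : ∀ i ∈ s, LocallyLipschitz (g i)) :
    LocallyLipschitz fun x => ∑ i ∈ s, g i x := by
  classical
  induction s using Finset.induction_on with
  | empty => simpa using LocallyLipschitz.const (0 : F)
  | insert i s hi ih =>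
    simp only [Finset.sum_insert hi]
    exact (hg i (Finset.mem_insert_self _ _)).add
      (ih fun j hj => hg j (Finset.mem_insert_of_mem hj))

theorem LocallyLipschitz.pi {ι E : Type*} [Fintype ι] [MetricSpace E] {F : ι → Type*}
    [∀ i, MetricSpace (F i)] {g : E → ∀ i, F i} (hg : ∀ i, LocallyLipschitz fun x => g x i) :
    LocallyLipschitz g := by
  intro x
  choose K t ht hK using fun i => hg i x
  refine ⟨Finset.univ.sup K, ⋂ i, t i, Filter.iInter_mem.2 ht, fun y hy z hz => ?_⟩
  refine edist_pi_le_iff.2 fun i => (hK i (mem_iInter.1 hy i) (mem_iInter.1 hz i)).trans ?_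
  gcongr
  exact Finset.le_sup (Finset.mem_univ i)

theorem locallyLipschitz_avgCoupling {g : ℝ → ℝ} (hg : LocallyLipschitz g) :
    LocallyLipschitz (avgCoupling g) := by
  have h1 : LocallyLipschitz fun p : ℝ × Plane =>
      -Real.sin p.1 * p.2 0 + Real.cos p.1 * p.2 1 :=
    ContDiff.locallyLipschitz (𝕂 := ℝ) (by fun_prop)
  have h2 : LocallyLipschitz fun p : ℝ × Plane => (!₂[-Real.sin p.1, Real.cos p.1] : Plane) :=
    ContDiff.locallyLipschitz (𝕂 := ℝ) (contDiff_euclidean.2 fun i => by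
      fin_cases i <;> simp <;> fun_prop)
  exact (LocallyLipschitz.const (1 / (2 * Real.pi))).smul_fun
    (((hg.comp h1).smul_fun h2).intervalIntegral 0 (2 * Real.pi))

theorem locallyLipschitz_avgDamping {f : ℝ → ℝ} (hf : LocallyLipschitz f) :
    LocallyLipschitz (avgDamping f) := by
  have h0 : LocallyLipschitz fun p : ℝ × Plane =>
      Real.cos p.1 * p.2 0 + Real.sin p.1 * p.2 1 :=
    ContDiff.locallyLipschitz (𝕂 := ℝ) (by fun_prop)
  have h1 : LocallyLipschitz fun p : ℝ × Plane =>
      -Real.sin p.1 * p.2 0 + Real.cos p.1 * p.2 1 :=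
    ContDiff.locallyLipschitz (𝕂 := ℝ) (by fun_prop)
  have h2 : LocallyLipschitz fun p : ℝ × Plane => (!₂[-Real.sin p.1, Real.cos p.1] : Plane) :=
    ContDiff.locallyLipschitz (𝕂 := ℝ) (contDiff_euclidean.2 fun i => by
      fin_cases i <;> simp <;> fun_prop)
  exact (LocallyLipschitz.const (1 / (2 * Real.pi))).smul_fun
    ((((hf.comp h0).smul_fun h1).smul_fun h2).intervalIntegral 0 (2 * Real.pi))

theorem locallyLipschitz_avgArray {m : ℕ} {f : ℝ → ℝ} {γ : Fin m → Fin m → ℝ → ℝ}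
    (hf : LocallyLipschitz f) (hγ : ∀ i j : Fin m, i ≠ j → LocallyLipschitz (γ i j)) :
    LocallyLipschitz (avgArray f γ) := by
  have happ (i : Fin m) : LocallyLipschitz fun η : ArrayState m => η i :=
    ContDiff.locallyLipschitz (𝕂 := ℝ) (by fun_prop)
  have hsub (i j : Fin m) : LocallyLipschitz fun η : ArrayState m => η j - η i :=
    ContDiff.locallyLipschitz (𝕂 := ℝ) (by fun_prop)
  have hneg : LocallyLipschitz fun v : Plane => -v :=
    ContDiff.locallyLipschitz (𝕂 := ℝ) (by fun_prop)
  have hLp : LocallyLipschitz (WithLp.toLp 2 : (Fin m → Plane) → ArrayState m) :=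
    (PiLp.lipschitzWith_toLp 2 _).locallyLipschitz
  refine hLp.comp (LocallyLipschitz.pi fun i => ?_)
  refine (hneg.comp ((locallyLipschitz_avgDamping hf).comp (happ i))).add
    (LocallyLipschitz.finset_sum _ fun j hj => ?_)
  exact (locallyLipschitz_avgCoupling (hγ i j (Finset.ne_of_mem_erase hj).symm)).comp (hsub i j)

/-! ### Differential inequalities, global solutions and cluster points. -/

/-- A maximum principle: the growth bound is needed only for a component that is currently largest
and above `L`, since only such a component can be the first to cross a barrier lying above `L`. -/
theorem family_le_of_deriv_le {ι : Type*} [Finite ι] {y y' : ι → ℝ → ℝ} {a L C : ℝ}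
    (hder : ∀ i, ∀ t ≥ a, HasDerivWithinAt (y i) (y' i t) (Ici a) t) (ha : ∀ i, y i a ≤ L)
    (hd : ∀ t ≥ a, ∀ i, L < y i t → (∀ j, y j t ≤ y i t) → y' i t ≤ C * (y i t - L)) :
    ∀ t ≥ a, ∀ i, y i t ≤ L := by
  intro T hT i₀
  have hcont (i : ι) : ContinuousOn (y i) (Ici a) := fun t ht => (hder i t ht).continuousWithinAt
  have key (ε : ℝ) (hε : 0 < ε) :
      Icc a T ⊆ {t | ∀ i, y i t ≤ L + ε * Real.exp ((C + 1) * (t - a))} := by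
    -- The rate `C + 1` exceeds `C`, so at a contact the barrier rises strictly faster than the
    -- component touching it; `ε` tends to `0` at the end.
    set B : ℝ → ℝ := fun t => L + ε * Real.exp ((C + 1) * (t - a)) with hB
    have hBc : Continuous B := by fun_prop
    refine IsClosed.Icc_subset_of_forall_mem_nhdsWithin ?_ ?_ ?_
    · have : {t | ∀ i, y i t ≤ B t} ∩ Icc a T = Icc a T ∩ ⋂ i, {t | t ∈ Icc a T ∧ y i t ≤ B t} := by
        ext t
        simp only [mem_inter_iff, mem_ofPred_eq, mem_iInter]
        grind
      rw [this]
      refine isClosed_Icc.inter (isClosed_iInter fun i => ?_)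
      exact isClosed_Icc.isClosed_le ((hcont i).mono Icc_subset_Ici_self) hBc.continuousOn
    · intro i
      simp only [sub_self, mul_zero, Real.exp_zero, mul_one]
      linarith [ha i]
    · rintro t ⟨hts, hat, -⟩
      refine (eventually_all.2 fun i => ?_ : ∀ᶠ z in 𝓝[>] t, ∀ i, y i z ≤ B z)
      have hmono : Ioi t ⊆ Ici a := fun z hz => hat.trans (le_of_lt hz)
      rcases (hts i).lt_or_eq with hlt | heq
      · have h1 : Tendsto (y i) (𝓝[>] t) (𝓝 (y i t)) := ((hcont i) t hat).mono hmono
        have h2 : Tendsto B (𝓝[>] t) (𝓝 (B t)) := hBc.continuousAt.mono_left nhdsWithin_le_nhds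
        exact (h1.eventually_lt h2 hlt).mono fun z hz => hz.le
      · have heq' : y i t = B t := heq
        have hpos : 0 < ε * Real.exp ((C + 1) * (t - a)) := by positivity
        have hy' := hd t hat i (by rw [heq']; simp only [hB]; linarith)
          fun j => (hts j).trans heq.ge
        have hBd : HasDerivAt B (ε * (Real.exp ((C + 1) * (t - a)) * ((C + 1) * 1))) t :=
          (((((hasDerivAt_id t).sub_const a).const_mul (C + 1)).exp).const_mul ε).const_add L
        have hdiff := ((hder i t hat).mono hmono).sub hBd.hasDerivWithinAt
        rw [hasDerivWithinAt_iff_tendsto_slope' self_notMem_Ioi] at hdiff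
        have hneg : y' i t - ε * (Real.exp ((C + 1) * (t - a)) * ((C + 1) * 1)) < 0 := by
          rw [heq', hB] at hy'
          simp only [add_sub_cancel_left] at hy'
          nlinarith
        filter_upwards [hdiff.eventually_lt_const hneg, self_mem_nhdsWithin] with z hz htz
        have hzt : 0 < z - t := sub_pos.2 htz
        rw [slope_def_field, div_neg_iff] at hz
        simp only [Pi.sub_apply, heq', sub_self, sub_zero] at hz
        rcases hz with hz | hz <;> linarith
  refine le_of_forall_pos_le_add fun δ hδ => ?_
  have h := key (δ / Real.exp ((C + 1) * (T - a))) (by positivity) (right_mem_Icc.2 hT) i₀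
  rwa [div_mul_cancel₀ _ (Real.exp_pos _).ne'] at h

theorem exists_isForwardSolution_of_bounded {E : Type*} [NormedAddCommGroup E] [NormedSpace ℝ E]
    [ProperSpace E] {X : E → E} (hX : LocallyLipschitz X) {L : ℝ} (hL : ∀ x, ‖X x‖ ≤ L) (x₀ : E) :
    ∃ x : ℝ → E, IsForwardSolution X x₀ x := by
  have hL0 : 0 ≤ L := (norm_nonneg _).trans (hL 0)
  have hex (n : ℕ) : ∃ α : ℝ → E, α 0 = x₀ ∧
      ∀ t ∈ Icc (0 : ℝ) (n + 1), HasDerivWithinAt α (X (α t)) (Icc (0 : ℝ) (n + 1)) t := by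
    obtain ⟨K, hK⟩ := hX.locallyLipschitzOn.exists_lipschitzOnWith_of_compact
      (isCompact_closedBall x₀ (L * (n + 1)))
    -- A curve of speed at most `L` stays in the ball of radius `L (n + 1)` up to time `n + 1`, so
    -- Picard–Lindelöf covers the whole interval.
    have hpl : IsPicardLindelof (fun _ : ℝ => X)
        (⟨0, left_mem_Icc.2 (by positivity)⟩ : Icc (0 : ℝ) (n + 1)) x₀
        (⟨L, hL0⟩ * (n + 1)) 0 ⟨L, hL0⟩ K :=
      { lipschitzOnWith := fun t _ => hK
        continuousOn := fun _ _ => continuousOn_const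
        norm_le := fun _ _ x _ => hL x
        mul_max_le := by
          simp only [sub_zero, NNReal.coe_zero]
          rw [max_eq_left (by positivity)]
          exact le_rfl }
    exact hpl.exists_eq_forall_mem_Icc_hasDerivWithinAt₀
  choose α hα0 hα using hex
  have hright {k : ℕ} {t : ℝ} (ht : t ∈ Ico (0 : ℝ) (k + 1)) :
      HasDerivWithinAt (α k) (X (α k t)) (Ici t) t :=
    (hα k t (Ico_subset_Icc_self ht)).mono_of_mem_nhdsWithin
      (mem_of_superset (Icc_mem_nhdsGE ht.2) (Icc_subset_Icc_left ht.1))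
  have huniq {k n : ℕ} (hkn : k ≤ n) : EqOn (α k) (α n) (Icc 0 (k + 1)) := by
    have hkn' : (k : ℝ) + 1 ≤ n + 1 := by exact_mod_cast Nat.succ_le_succ hkn
    have hc1 : ContinuousOn (α k) (Icc 0 (k + 1)) := fun t ht => (hα k t ht).continuousWithinAt
    have hc2 : ContinuousOn (α n) (Icc 0 (k + 1)) := fun t ht =>
      ((hα n t (Icc_subset_Icc_right hkn' ht)).continuousWithinAt).mono (Icc_subset_Icc_right hkn')
    obtain ⟨K, hK⟩ := hX.locallyLipschitzOn.exists_lipschitzOnWith_of_compact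
      ((isCompact_Icc.image_of_continuousOn hc1).union (isCompact_Icc.image_of_continuousOn hc2))
    exact ODE_solution_unique_of_mem_Icc_right (v := fun _ => X) (fun _ _ => hK) hc1
      (fun t ht => hright ht) (fun t ht => Or.inl ⟨t, Ico_subset_Icc_self ht, rfl⟩) hc2
      (fun t ht => hright ⟨ht.1, ht.2.trans_le hkn'⟩)
      (fun t ht => Or.inr ⟨t, Ico_subset_Icc_self ht, rfl⟩) ((hα0 k).trans (hα0 n).symm)
  -- The solution indexed by `⌊t⌋₊` lives on `[0, ⌊t⌋₊ + 1]`, which extends strictly past `t`;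
  -- uniqueness makes the pieces agree.
  refine ⟨fun t => α ⌊t⌋₊ t, by simp [hα0], fun t ht => ?_⟩
  have ht0 : (0 : ℝ) ≤ t := ht
  have hlt : t < ⌊t⌋₊ + 1 := Nat.lt_floor_add_one t
  have hev : (fun s => α ⌊s⌋₊ s) =ᶠ[𝓝[Ici 0] t] α ⌊t⌋₊ := by
    filter_upwards [self_mem_nhdsWithin, nhdsWithin_le_nhds (gt_mem_nhds hlt)] with s hs hst
    have hs0 : (0 : ℝ) ≤ s := hs
    have hfl : ⌊s⌋₊ ≤ ⌊t⌋₊ := by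
      have : ⌊s⌋₊ < ⌊t⌋₊ + 1 := (Nat.floor_lt hs0).2 (by exact_mod_cast hst)
      omega
    exact huniq hfl ⟨hs0, (Nat.lt_floor_add_one s).le⟩
  refine HasDerivWithinAt.congr_of_eventuallyEq ?_ hev rfl
  refine (hα ⌊t⌋₊ t ⟨ht0, hlt.le⟩).mono_of_mem_nhdsWithin ?_
  filter_upwards [self_mem_nhdsWithin, nhdsWithin_le_nhds (gt_mem_nhds hlt)] with s hs hst
    using ⟨hs, hst.le⟩

theorem IsForwardSolution.hasDerivWithinAt_clm {E : Type*} [NormedAddCommGroup E] [NormedSpace ℝ E]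
    {X : E → E} {x₀ : E} {x : ℝ → E} (hx : IsForwardSolution X x₀ x) (ψ : E →L[ℝ] ℝ) {t₀ t : ℝ}
    (ht₀ : 0 ≤ t₀) (ht : t₀ ≤ t) :
    HasDerivWithinAt (fun t => ψ (x t)) (ψ (X (x t))) (Ici t₀) t :=
  ψ.hasFDerivAt.comp_hasDerivWithinAt t
    ((hx.2 t (ht₀.trans ht)).mono (Ici_subset_Ici.2 ht₀))

theorem IsForwardSolution.continuousOn {E : Type*} [NormedAddCommGroup E] [NormedSpace ℝ E]
    {X : E → E} {x₀ : E} {x : ℝ → E} (hx : IsForwardSolution X x₀ x) : ContinuousOn x (Ici 0) :=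
  fun t ht => (hx.2 t ht).continuousWithinAt

/-- This plays the role of LaSalle's principle. If `ψ` decreased along the field at `y`, then, the
speed being bounded, it would decrease at rate `ε` throughout a time `τ` before each close visit to
`y`. So `ψ` would have exceeded `L` by a fixed amount at arbitrarily late times. -/
theorem IsForwardSolution.le_apply_of_mapClusterPt {E : Type*} [NormedAddCommGroup E]
    [NormedSpace ℝ E] {X : E → E} {x₀ : E} {x : ℝ → E} (hx : IsForwardSolution X x₀ x)
    (hX : Continuous X) {S : ℝ} (hS : ∀ t ≥ 0, ‖X (x t)‖ ≤ S) (ψ : E →L[ℝ] ℝ) {L : ℝ}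
    (hL : ∀ ε > 0, ∀ᶠ t in atTop, ψ (x t) < L + ε) {y : E} (hy : MapClusterPt y atTop x)
    (hyL : ψ y = L) : 0 ≤ ψ (X y) := by
  by_contra! hneg
  set ε := -ψ (X y) / 2 with hε
  have hε0 : 0 < ε := by linarith
  have hS0 : 0 ≤ S := (norm_nonneg _).trans (hS 0 le_rfl)
  have hnear : ∀ᶠ z in 𝓝 y, ψ (X z) < -ε :=
    (ψ.continuous.comp hX).continuousAt.eventually_lt_const (by simp only [Function.comp]; linarith)
  obtain ⟨r, hr, hball⟩ := Metric.eventually_nhds_iff.1 hnear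
  set τ := r / (2 * (S + 1)) with hτ
  have hτ0 : 0 < τ := by positivity
  have hSτ : S * τ < r / 2 := by
    rw [hτ, ← div_div, mul_div_assoc', div_lt_iff₀ (by positivity)]
    nlinarith
  have hev : ∀ᶠ t in atTop, τ ≤ t ∧ ψ (x (t - τ)) < L + ε * τ / 2 :=
    (eventually_ge_atTop τ).and
      ((tendsto_atTop_add_const_right atTop (-τ) tendsto_id).eventually
        (hL (ε * τ / 2) (by positivity)))
  have hfr : ∃ᶠ t in atTop, dist (x t) y < r / 2 ∧ L - ε * τ / 2 < ψ (x t) := by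
    refine hy.frequently (p := fun z => dist z y < r / 2 ∧ L - ε * τ / 2 < ψ z)
      (Filter.Eventually.and (Metric.ball_mem_nhds y (half_pos hr)) ?_)
    exact ψ.continuous.continuousAt.eventually_const_lt
      (by rw [hyL]; linarith [mul_pos hε0 hτ0])
  obtain ⟨t, ⟨htd, htL⟩, htτ, htb⟩ := (hfr.and_eventually hev).exists
  have hsub : Icc (t - τ) t ⊆ Ici 0 := fun s hs => by
    have := hs.1
    simp only [mem_Ici]
    linarith
  have hclose (s : ℝ) (hs : s ∈ Icc (t - τ) t) : ψ (X (x s)) < -ε := by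
    refine hball ?_
    have h := (convex_Icc (t - τ) t).norm_image_sub_le_of_norm_hasDerivWithin_le
      (fun u hu => (hx.2 u (hsub hu)).mono hsub) (fun u hu => hS u (hsub hu)) hs
      (right_mem_Icc.2 (by linarith))
    have h2 : ‖t - s‖ ≤ τ := by
      rw [Real.norm_eq_abs, abs_le]
      constructor <;> linarith [hs.1, hs.2]
    have h3 : dist (x s) (x t) ≤ S * τ := by
      rw [dist_comm, dist_eq_norm]
      exact h.trans (mul_le_mul_of_nonneg_left h2 hS0)
    linarith [dist_triangle (x s) (x t) y]
  have hdec := (convex_Icc (t - τ) t).image_sub_le_mul_sub_of_deriv_le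
    (f := fun s => ψ (x s)) (C := -ε)
    (ψ.continuous.comp_continuousOn (hx.continuousOn.mono hsub)) ?_ ?_ (t - τ)
    (left_mem_Icc.2 (by linarith)) t (right_mem_Icc.2 (by linarith)) (by linarith)
  · simp only [sub_sub_cancel] at hdec
    nlinarith
  all_goals
    intro s hs
    rw [interior_Icc] at hs
    have hs' := Ioo_subset_Icc_self hs
    have h0 : 0 < s := by linarith [hs.1]
    have hd : HasDerivAt (fun s => ψ (x s)) (ψ (X (x s))) s :=
      (hx.hasDerivWithinAt_clm ψ le_rfl h0.le).hasDerivAt (Ici_mem_nhds h0)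
  · exact hd.differentiableAt.differentiableWithinAt
  · rw [hd.deriv]
    exact (hclose s hs').le

/-! ### Radial arrays: invariant regions and existence. -/

/-- `X` is an array of planar oscillators with radial damping of gain `a` (negative inside and
positive outside the circle of radius `ρ`) and attractive coupling of gains `b i j`, which are
positive along the edges `e`. -/
structure IsRadialArray {m : ℕ} (X : ArrayState m → ArrayState m) (ρ : ℝ) (a : Plane → ℝ)
    (b : Fin m → Fin m → Plane → ℝ) (e : Fin m → Fin m → Prop) : Prop where
  apply_eq : ∀ η i, X η i =
    -(a (η i) • η i) + ∑ j ∈ Finset.univ.erase i, b i j (η j - η i) • (η j - η i)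
  locallyLipschitz : LocallyLipschitz X
  radius_pos : 0 < ρ
  damping_neg : ∀ v, v ≠ 0 → ‖v‖ < ρ → a v < 0
  damping_pos : ∀ v, ρ < ‖v‖ → 0 < a v
  damping_lower : ∃ C, ∀ v, -C ≤ a v
  coupling_nonneg : ∀ i j, i ≠ j → ∀ v, 0 ≤ b i j v
  coupling_pos : ∀ i j, e i j → i ≠ j ∧ ∀ v, v ≠ 0 → 0 < b i j v

theorem IsIntegralCurveOn.hasDerivWithinAt_clm {E F : Type*} [NormedAddCommGroup E]
    [NormedSpace ℝ E] [NormedAddCommGroup F] [NormedSpace ℝ F] {V : ℝ → E → E} {x : ℝ → E}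
    {s : Set ℝ} (hx : IsIntegralCurveOn x V s) (ψ : E →L[ℝ] F) {t : ℝ} (ht : t ∈ s) :
    HasDerivWithinAt (fun t => ψ (x t)) (ψ (V t (x t))) s t :=
  ψ.hasFDerivAt.comp_hasDerivWithinAt t (hx t ht)

theorem IsIntegralCurveOn.congr_field {E : Type*} [NormedAddCommGroup E] [NormedSpace ℝ E]
    {V W : ℝ → E → E} {x : ℝ → E} {s : Set ℝ} (hx : IsIntegralCurveOn x V s)
    (h : ∀ t ∈ s, V t (x t) = W t (x t)) : IsIntegralCurveOn x W s :=
  fun t ht => h t ht ▸ hx t ht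

theorem ArrayState.norm_le_mul {m : ℕ} {η : ArrayState m} {R : ℝ} (hη : ∀ i, ‖η i‖ ≤ R) :
    ‖η‖ ≤ m * R := by
  rcases m.eq_zero_or_pos with rfl | hm
  · simp [Subsingleton.elim η 0]
  have hR : 0 ≤ R := (norm_nonneg _).trans (hη ⟨0, hm⟩)
  refine abs_le_of_sq_le_sq' ?_ (by positivity) |>.2
  rw [PiLp.norm_sq_eq_of_L2]
  calc ∑ i, ‖η i‖ ^ 2 ≤ ∑ _i : Fin m, R ^ 2 :=
        Finset.sum_le_sum fun i _ => pow_le_pow_left₀ (norm_nonneg _) (hη i) 2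
    _ = m * R ^ 2 := by simp
    _ ≤ (m * R) ^ 2 := by
        rw [mul_pow]
        have : (1 : ℝ) ≤ m := by exact_mod_cast hm
        exact mul_le_mul_of_nonneg_right (by nlinarith) (sq_nonneg R)

/-- The functional `φ` of the `i`-th component. -/
noncomputable def componentFunctional {m : ℕ} (φ : Plane →L[ℝ] ℝ) (i : Fin m) :
    ArrayState m →L[ℝ] ℝ :=
  φ.comp (PiLp.proj 2 (𝕜 := ℝ) (fun _ : Fin m => Plane) i)

@[simp]
theorem componentFunctional_apply {m : ℕ} (φ : Plane →L[ℝ] ℝ) (i : Fin m) (η : ArrayState m) :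
    componentFunctional φ i η = φ (η i) := rfl

namespace IsRadialArray

variable {m : ℕ} {X : ArrayState m → ArrayState m} {ρ : ℝ} {a : Plane → ℝ}
  {b : Fin m → Fin m → Plane → ℝ} {e : Fin m → Fin m → Prop}

theorem map_apply (h : IsRadialArray X ρ a b e) (φ : Plane →L[ℝ] ℝ) (η : ArrayState m)
    (i : Fin m) : φ (X η i) = -(a (η i) * φ (η i)) +
      ∑ j ∈ Finset.univ.erase i, b i j (η j - η i) * (φ (η j) - φ (η i)) := by
  simp [h.apply_eq, map_sum]

theorem map_apply_le_of_max (h : IsRadialArray X ρ a b e) (φ : Plane →L[ℝ] ℝ)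
    {η : ArrayState m} {i : Fin m} (hi : ∀ j, φ (η j) ≤ φ (η i)) :
    φ (X η i) ≤ -(a (η i) * φ (η i)) := by
  rw [h.map_apply]
  refine add_le_of_nonpos_right (Finset.sum_nonpos fun j hj => ?_)
  exact mul_nonpos_of_nonneg_of_nonpos
    (h.coupling_nonneg i j (Finset.ne_of_mem_erase hj).symm _) (sub_nonpos.2 (hi j))

/-- At an outermost agent `i`, Cauchy–Schwarz makes `⟪xᵢ, ·⟫` maximal, so coupling does not increase
its norm, and damping decreases it outside radius `ρ`. The time factor `c` lets the bound apply to a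
truncated field as well. -/
theorem norm_le_of_scaled (h : IsRadialArray X ρ a b e) {x : ℝ → ArrayState m} {c : ℝ → ℝ}
    (hc : ∀ t, 0 ≤ c t)
    (hx : IsIntegralCurveOn x (fun t η => c t • X η) (Ici 0)) {R : ℝ} (hR : ρ ≤ R)
    (h0 : ∀ i, ‖x 0 i‖ ≤ R) : ∀ t ≥ 0, ∀ i, ‖x t i‖ ≤ R := by
  have hR0 : 0 < R := h.radius_pos.trans_le hR
  have hd (i : Fin m) (t : ℝ) (ht : t ≥ 0) : HasDerivWithinAt (fun t => ‖x t i‖ ^ 2)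
      (2 * inner ℝ (x t i) (c t • X (x t) i)) (Ici 0) t := by
    have hi : HasDerivWithinAt (fun t => x t i) (c t • X (x t) i) (Ici 0) t :=
      hx.hasDerivWithinAt_clm (PiLp.proj 2 (𝕜 := ℝ) (fun _ : Fin m => Plane) i) ht
    exact hi.norm_sq
  have hinit (i : Fin m) : ‖x 0 i‖ ^ 2 ≤ R ^ 2 := pow_le_pow_left₀ (norm_nonneg _) (h0 i) 2
  have := family_le_of_deriv_le (C := 0) (L := R ^ 2) (a := 0) (y := fun i t => ‖x t i‖ ^ 2)
    (y' := fun i t => 2 * inner ℝ (x t i) (c t • X (x t) i)) hd hinit fun t ht i hi hmax => ?_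
  · exact fun t ht i => abs_le_of_sq_le_sq' (this t ht i) hR0.le |>.2
  have hRi : R < ‖x t i‖ := lt_of_pow_lt_pow_left₀ 2 (norm_nonneg _) hi
  have hmax' (j : Fin m) : ‖x t j‖ ≤ ‖x t i‖ :=
    abs_le_of_sq_le_sq' (hmax j) (norm_nonneg _) |>.2
  have hin := h.map_apply_le_of_max (innerSL ℝ (x t i)) (η := x t) (i := i) fun j => by
    simp only [innerSL_apply_apply, real_inner_self_eq_norm_sq]
    exact (real_inner_le_norm _ _).trans (by nlinarith [hmax' j, norm_nonneg (x t i)])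
  simp only [innerSL_apply_apply, real_inner_self_eq_norm_sq] at hin
  have hapos := h.damping_pos (x t i) (hR.trans_lt hRi)
  rw [inner_smul_right, zero_mul]
  have : inner ℝ (x t i) (X (x t) i) ≤ 0 := hin.trans (by nlinarith [sq_nonneg ‖x t i‖])
  nlinarith [hc t]

theorem norm_le (h : IsRadialArray X ρ a b e) {x₀ : ArrayState m} {x : ℝ → ArrayState m}
    (hx : IsForwardSolution X x₀ x) {R : ℝ} (hR : ρ ≤ R)
    (h0 : ∀ i, ‖x₀ i‖ ≤ R) : ∀ t ≥ 0, ∀ i, ‖x t i‖ ≤ R :=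
  h.norm_le_of_scaled (c := fun _ => 1) (fun _ => zero_le_one)
    (hx.2.congr_field fun t _ => (one_smul ℝ _).symm) hR (by rwa [hx.1])

theorem exists_solution (h : IsRadialArray X ρ a b e) (x₀ : ArrayState m) :
    ∃ x, IsForwardSolution X x₀ x := by
  set R := max ρ ‖x₀‖
  -- The cutoff is `1` on the ball of radius `m * R`, which contains the a priori bound on the
  -- stacked state, and `0` beyond radius `m * R + 1`. The truncated solution never meets the
  -- truncation.
  set χ : ArrayState m → ℝ := fun η => max (min (m * R + 1 - ‖η‖) 1) 0 with hχ
  have hχlip : LocallyLipschitz χ := by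
    refine LocallyLipschitz.max_const (LocallyLipschitz.min_const ?_ 1) 0
    refine LipschitzWith.locallyLipschitz (K := 1) (LipschitzWith.of_dist_le_mul fun x y => ?_)
    rw [Real.dist_eq, NNReal.coe_one, one_mul, dist_eq_norm, sub_sub_sub_cancel_left, abs_sub_comm]
    exact abs_norm_sub_norm_le x y
  have hχ0 (η : ArrayState m) : 0 ≤ χ η := le_max_right _ _
  obtain ⟨S, hS⟩ := (isCompact_closedBall (0 : ArrayState m) (m * R + 1)).exists_bound_of_continuousOn
    h.locallyLipschitz.continuous.continuousOn
  have hbound (η : ArrayState m) : ‖χ η • X η‖ ≤ max S 0 := by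
    rw [norm_smul, Real.norm_of_nonneg (hχ0 η)]
    rcases le_or_gt ‖η‖ (m * R + 1) with hle | hgt
    · have h1 : χ η ≤ 1 := max_le (min_le_right _ _) zero_le_one
      have h2 := hS η (by simpa using hle)
      exact (mul_le_of_le_one_left (norm_nonneg _) h1).trans (h2.trans (le_max_left _ _))
    · have h0 : χ η = 0 := max_eq_right ((min_le_left _ _).trans (by linarith))
      rw [h0, zero_mul]
      exact le_max_right _ _
  obtain ⟨x, hx0, hx⟩ := exists_isForwardSolution_of_bounded
    (hχlip.smul_fun h.locallyLipschitz) hbound x₀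
  have hle := h.norm_le_of_scaled (c := fun t => χ (x t)) (fun t => hχ0 _)
    (hx.congr_field fun _ _ => rfl) (le_max_left _ _)
    (R := R) fun i => by
      rw [hx0]
      exact (PiLp.norm_apply_le x₀ i).trans (le_max_right _ _)
  refine ⟨x, hx0, hx.congr_field fun t ht => ?_⟩
  have hχ1 : χ (x t) = 1 := by
    have := ArrayState.norm_le_mul (hle t ht)
    simp only [hχ]
    rw [min_eq_right (by linarith), max_eq_left zero_le_one]
  simp only [hχ1, one_smul]

/-- Radial damping contributes `-a φ ≤ C φ` where `φ > 0`, so it cannot carry an agent across the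
line `φ = 0`. -/
theorem map_nonpos (h : IsRadialArray X ρ a b e) {x₀ : ArrayState m} {x : ℝ → ArrayState m}
    (hx : IsForwardSolution X x₀ x) (φ : Plane →L[ℝ] ℝ) {t₀ : ℝ} (ht₀ : 0 ≤ t₀)
    (h0 : ∀ i, φ (x t₀ i) ≤ 0) : ∀ t ≥ t₀, ∀ i, φ (x t i) ≤ 0 := by
  obtain ⟨C, hC⟩ := h.damping_lower
  refine family_le_of_deriv_le (C := C) (y := fun i t => φ (x t i))
    (fun i t ht => hx.hasDerivWithinAt_clm (componentFunctional φ i) ht₀ ht) h0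
    fun t ht i hi hmax => ?_
  have := h.map_apply_le_of_max φ hmax
  simp only [componentFunctional_apply, sub_zero]
  nlinarith [hC (x t i)]

/-- An agent with `p < p₀` has norm below `D * p₀ ≤ ρ`, where damping pushes outwards and hence
increases `p`. -/
theorem le_map (h : IsRadialArray X ρ a b e) {x₀ : ArrayState m} {x : ℝ → ArrayState m}
    (hx : IsForwardSolution X x₀ x) (p : Plane →L[ℝ] ℝ) {D p₀ : ℝ} (hD : 0 < D)
    (hpD : ∀ t ≥ 0, ∀ i, ‖x t i‖ ≤ D * p (x t i)) (hp₀ : D * p₀ ≤ ρ) (h0 : ∀ i, p₀ ≤ p (x₀ i)) :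
    ∀ t ≥ 0, ∀ i, p₀ ≤ p (x t i) := by
  have := family_le_of_deriv_le (C := 0) (L := -p₀) (y := fun i t => (-p) (x t i))
    (fun i t ht => hx.hasDerivWithinAt_clm (componentFunctional (-p) i) le_rfl ht)
    (fun i => by simpa [hx.1] using h0 i) fun t ht i hi hmax => ?_
  · exact fun t ht i => neg_le_neg_iff.1 (this t ht i)
  have hle := h.map_apply_le_of_max (-p) hmax
  simp only [componentFunctional_apply, zero_mul]
  refine hle.trans ?_
  have hlt : p (x t i) < p₀ := neg_lt_neg_iff.1 hi
  have hnorm := hpD t ht i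
  simp only [neg_apply, mul_neg, neg_neg]
  by_cases hv : x t i = 0
  · simp [hv]
  have hneg := h.damping_neg _ hv (hnorm.trans_lt ((mul_lt_mul_of_pos_left hlt hD).trans_le hp₀))
  have hp : 0 ≤ p (x t i) := nonneg_of_mul_nonneg_right ((norm_nonneg _).trans hnorm) hD
  exact mul_nonpos_of_nonpos_of_nonneg hneg.le hp

theorem sector_invariant (h : IsRadialArray X ρ a b e) {x₀ : ArrayState m}
    {x : ℝ → ArrayState m} (hx : IsForwardSolution X x₀ x) {p w : Plane →L[ℝ] ℝ}
    (hpw : ∀ v, ‖v‖ ^ 2 = p v ^ 2 + w v ^ 2) {Q p₀ : ℝ} (hQ : 0 < Q) (hp₀ : (1 + Q) * p₀ ≤ ρ)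
    (h0 : ∀ i, p₀ ≤ p (x₀ i)) (hw : ∀ i, |w (x₀ i)| ≤ Q * p (x₀ i)) :
    ∀ t ≥ 0, ∀ i, p₀ ≤ p (x t i) ∧ |w (x t i)| ≤ Q * p (x t i) := by
  have h1 := h.map_nonpos hx (w - Q • p) le_rfl fun i => by
    rw [hx.1]
    simpa using (abs_le.1 (hw i)).2
  have h2 := h.map_nonpos hx (-w - Q • p) le_rfl fun i => by
    rw [hx.1]
    simpa using neg_le.1 (abs_le.1 (hw i)).1
  have hsec (t : ℝ) (ht : t ≥ 0) (i : Fin m) : |w (x t i)| ≤ Q * p (x t i) := by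
    have h1 := h1 t ht i
    have h2 := h2 t ht i
    simp only [sub_apply, smul_apply,
      neg_apply, smul_eq_mul] at h1 h2
    exact abs_le.2 ⟨by linarith, by linarith⟩
  -- In the sector, `‖v‖² = p² + w² ≤ (1 + Q²) p² ≤ ((1 + Q) p)²`.
  have hp := h.le_map hx p (D := 1 + Q) (by positivity) (fun t ht i => ?_) hp₀ h0
  · exact fun t ht i => ⟨hp t ht i, hsec t ht i⟩
  have hs := hsec t ht i
  have hp : 0 ≤ p (x t i) := nonneg_of_mul_nonneg_right ((abs_nonneg _).trans hs) hQ
  refine abs_le_of_sq_le_sq' ?_ (by positivity) |>.2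
  have : w (x t i) ^ 2 ≤ (Q * p (x t i)) ^ 2 := sq_le_sq' (abs_le.1 hs).1 (abs_le.1 hs).2
  rw [hpw]
  nlinarith [mul_nonneg hQ.le (sq_nonneg (p (x t i)))]

end IsRadialArray

/-! ### Cluster points and convergence. -/

/-- The cluster set is compact and nonempty, so the maximum over it and over the agents exists.
Exceeding it by `ε` infinitely often would create a cluster point with a larger value. -/
theorem exists_mapClusterPt_isMax {m : ℕ} [Nonempty (Fin m)] {x : ℝ → ArrayState m} {N : ℝ}
    (hx : ∀ t ≥ 0, ‖x t‖ ≤ N) (φ : Plane →L[ℝ] ℝ) :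
    ∃ y, MapClusterPt y atTop x ∧ ∃ i, (∀ z, MapClusterPt z atTop x → ∀ j, φ (z j) ≤ φ (y i)) ∧
      ∀ ε > 0, ∀ᶠ t in atTop, ∀ j, φ (x t j) < φ (y i) + ε := by
  have hev : ∀ᶠ t in atTop, x t ∈ Metric.closedBall (0 : ArrayState m) N :=
    (eventually_ge_atTop 0).mono fun t ht => by simpa using hx t ht
  have hK := isCompact_closedBall (0 : ArrayState m) N
  have hΩ : IsCompact {y | MapClusterPt y atTop x} := by
    refine hK.of_isClosed_subset isClosed_setOfPred_clusterPt fun y hy => ?_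
    exact Metric.isClosed_closedBall.mem_of_mapClusterPt hy hev
  obtain ⟨y₀, -, hy₀⟩ := hK.exists_mapClusterPt_of_frequently hev.frequently
  have hmax (i : Fin m) : ∃ y ∈ {y | MapClusterPt y atTop x},
      IsMaxOn (componentFunctional φ i) {y | MapClusterPt y atTop x} y :=
    hΩ.exists_isMaxOn ⟨y₀, hy₀⟩ (componentFunctional φ i).continuous.continuousOn
  choose y hy hymax using hmax
  obtain ⟨i, hi⟩ := Finite.exists_max fun i => φ (y i i)
  have hbound (z : ArrayState m) (hz : MapClusterPt z atTop x) (j : Fin m) :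
      φ (z j) ≤ φ (y i i) := (hymax j hz).trans (hi j)
  refine ⟨y i, hy i, i, hbound, fun ε hε => ?_⟩
  by_contra hcon
  have hfr : ∃ᶠ t in atTop, x t ∈ Metric.closedBall (0 : ArrayState m) N ∩
      ⋃ j, {z | φ (y i i) + ε ≤ componentFunctional φ j z} := by
    refine ((Filter.not_eventually.1 hcon).and_eventually hev).mono fun t ht => ?_
    obtain ⟨h1, h2⟩ := ht
    push Not at h1
    exact ⟨h2, mem_iUnion.2 h1⟩
  obtain ⟨z, ⟨-, hz⟩, hzc⟩ := (hK.inter_right (isClosed_iUnion_of_finite fun j =>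
    isClosed_le continuous_const (componentFunctional φ j).continuous)).exists_mapClusterPt_of_frequently
      hfr
  obtain ⟨j, hj⟩ := mem_iUnion.1 hz
  have : φ (y i i) + ε ≤ φ (z j) := hj
  linarith [hbound z hzc j]

namespace IsRadialArray

variable {m : ℕ} {X : ArrayState m → ArrayState m} {ρ : ℝ} {a : Plane → ℝ}
  {b : Fin m → Fin m → Plane → ℝ} {e : Fin m → Fin m → Prop}

/-- Take `c` to be the infimum of the slopes `d` for which all agents are at some time in the
half-plane `w ≤ d p`, which they then never leave. At a cluster point some agent lies on the
limiting line. Its damping term drops out, so nonnegativity of the derivative forces every agent it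
listens to onto the line as well, and a directed path leads to `l`. -/
theorem exists_slope (h : IsRadialArray X ρ a b e) {l : Fin m}
    (hl : ∀ k, k ≠ l → Relation.TransGen e k l) {x₀ : ArrayState m} {x : ℝ → ArrayState m}
    (hx : IsForwardSolution X x₀ x) {S N : ℝ} (hS : ∀ t ≥ 0, ‖X (x t)‖ ≤ S)
    (hN : ∀ t ≥ 0, ‖x t‖ ≤ N) {p w : Plane →L[ℝ] ℝ} {p₀ Q : ℝ} (hp₀ : 0 < p₀)
    (hp : ∀ t ≥ 0, ∀ i, p₀ ≤ p (x t i)) (hw : ∀ t ≥ 0, ∀ i, |w (x t i)| ≤ Q * p (x t i)) :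
    ∃ c : ℝ, ∀ y, MapClusterPt y atTop x →
      (∀ j, w (y j) ≤ c * p (y j)) ∧ w (y l) = c * p (y l) := by
  set A : Set ℝ := {c | ∃ t ≥ 0, ∀ i, (w - c • p) (x t i) ≤ 0} with hA
  have hAne : A.Nonempty := ⟨Q, 0, le_rfl, fun i => by
    simpa using (abs_le.1 (hw 0 le_rfl i)).2⟩
  have hAbdd : BddBelow A := by
    refine ⟨-Q, ?_⟩
    rintro c ⟨t, ht, hc⟩
    have h1 := hc l
    have h2 := (abs_le.1 (hw t ht l)).1
    have h3 := hp t ht l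
    simp only [sub_apply, smul_apply, smul_eq_mul] at h1
    by_contra! hlt
    nlinarith
  have hpbd : ∃ P > 0, ∀ t ≥ 0, ∀ i, p (x t i) ≤ P := by
    refine ⟨‖p‖ * |N| + 1, by positivity, fun t ht i => ?_⟩
    have h1 := (le_abs_self _).trans (p.le_opNorm (x t i))
    have h2 : ‖x t i‖ ≤ |N| := (PiLp.norm_apply_le (x t) i).trans ((hN t ht).trans (le_abs_self N))
    nlinarith [norm_nonneg p]
  obtain ⟨P, hP0, hP⟩ := hpbd
  set c := sInf A
  have hup (ε : ℝ) (hε : 0 < ε) : ∀ᶠ t in atTop, ∀ i, (w - c • p) (x t i) < 0 + ε := by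
    obtain ⟨d, ⟨t₀, ht₀, hd⟩, hdlt⟩ := exists_lt_of_csInf_lt hAne
      (show sInf A < c + ε / P by linarith [div_pos hε hP0])
    filter_upwards [eventually_ge_atTop t₀] with t ht i
    have h1 := h.map_nonpos hx _ ht₀ hd t ht i
    have h2 := hP t (ht₀.trans ht) i
    have h3 := hp t (ht₀.trans ht) i
    simp only [sub_apply, smul_apply, smul_eq_mul] at h1 ⊢
    have h4 : (d - c) * p (x t i) < ε / P * p (x t i) :=
      mul_lt_mul_of_pos_right (by linarith) (by linarith)
    have h5 : ε / P * p (x t i) ≤ ε / P * P := mul_le_mul_of_nonneg_left h2 (by positivity)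
    rw [div_mul_cancel₀ _ hP0.ne'] at h5
    linarith
  have hlow (y : ArrayState m) (hy : MapClusterPt y atTop x) : ∃ i, 0 ≤ (w - c • p) (y i) := by
    by_contra! hneg
    have hcont (i : Fin m) : Continuous fun q : ℝ × ArrayState m => w (q.2 i) - q.1 * p (q.2 i) := by
      fun_prop
    -- Strictness at `(c, y)` survives a joint perturbation of slope and state, which would put some
    -- `d < c` into `A`.
    have hev : ∀ᶠ q : ℝ × ArrayState m in 𝓝 (c, y), ∀ i, w (q.2 i) - q.1 * p (q.2 i) < 0 :=
      eventually_all.2 fun i => (hcont i).continuousAt.eventually_lt_const (by simpa using hneg i)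
    rw [nhds_prod_eq] at hev
    obtain ⟨U, hU, V, hV, hUV⟩ := eventually_prod_iff.1 hev
    have hU' : ∀ᶠ d in 𝓝[<] c, U d := hU.filter_mono nhdsWithin_le_nhds
    obtain ⟨d, hd, hdc⟩ := (hU'.and self_mem_nhdsWithin).exists
    obtain ⟨t, ht, ht0⟩ := ((hy.frequently hV).and_eventually (eventually_ge_atTop 0)).exists
    have hdA : d ∈ A := ⟨t, ht0, fun i => by simpa using (hUV hd ht i).le⟩
    exact absurd (csInf_le hAbdd hdA) (not_le.2 hdc)
  refine ⟨c, fun y hy => ?_⟩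
  have hle (j : Fin m) : (w - c • p) (y j) ≤ 0 := by
    by_contra! hpos
    have hev := ((componentFunctional (w - c • p) j).continuous.continuousAt (x := y)).eventually
      (lt_mem_nhds (show (w - c • p) (y j) / 2 < componentFunctional (w - c • p) j y by
        rw [componentFunctional_apply]; linarith))
    obtain ⟨t, ht1, ht2⟩ := ((hy.frequently hev).and_eventually
      (hup ((w - c • p) (y j) / 2) (by linarith))).exists
    have := ht2 j
    rw [zero_add] at this
    exact lt_asymm this ht1
  have hstep (i j : Fin m) (hi : (w - c • p) (y i) = 0) (hij : e i j) : (w - c • p) (y j) = 0 := by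
    obtain ⟨hne, hpos⟩ := h.coupling_pos i j hij
    have h0 := hx.le_apply_of_mapClusterPt h.locallyLipschitz.continuous hS
      (componentFunctional (w - c • p) i) (L := 0)
      (fun ε hε => (hup ε hε).mono fun t ht => ht i) hy hi
    rw [componentFunctional_apply, h.map_apply, hi, mul_zero, neg_zero, zero_add] at h0
    simp only [sub_zero] at h0
    have hnonpos (k : Fin m) (hk : k ∈ Finset.univ.erase i) :
        b i k (y k - y i) * (w - c • p) (y k) ≤ 0 :=
      mul_nonpos_of_nonneg_of_nonpos (h.coupling_nonneg i k (Finset.ne_of_mem_erase hk).symm _)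
        (hle k)
    have hz := (Finset.sum_eq_zero_iff_of_nonpos hnonpos).1
      (le_antisymm (Finset.sum_nonpos hnonpos) h0) j (Finset.mem_erase.2 ⟨hne.symm, Finset.mem_univ _⟩)
    by_cases hv : y j - y i = 0
    · rw [sub_eq_zero.1 hv, hi]
    · exact (mul_eq_zero.1 hz).resolve_left (hpos _ hv).ne'
  refine ⟨fun j => by simpa using hle j, ?_⟩
  obtain ⟨k, hk⟩ := hlow y hy
  have hk0 : (w - c • p) (y k) = 0 := le_antisymm (hle k) hk
  have hl0 : (w - c • p) (y l) = 0 := by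
    by_cases hkl : k = l
    · rw [← hkl, hk0]
    have htrans (j : Fin m) (hj : Relation.TransGen e k j) : (w - c • p) (y j) = 0 := by
      induction hj with
      | single hj => exact hstep _ _ hk0 hj
      | tail _ hj ih => exact hstep _ _ ih hj
    exact htrans l (hl k hkl)
  simpa [sub_eq_zero] using hl0

theorem exists_tendsto (h : IsRadialArray X ρ a b e) {l : Fin m}
    (hl : ∀ k, k ≠ l → Relation.TransGen e k l) {x₀ : ArrayState m} {x : ℝ → ArrayState m}
    (hx : IsForwardSolution X x₀ x) {p w : Plane →L[ℝ] ℝ}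
    (hpw : ∀ v, ‖v‖ ^ 2 = p v ^ 2 + w v ^ 2) (hpos : ∀ i, 0 < p (x₀ i)) :
    ∃ y ∈ syncSet m ρ, Tendsto x atTop (𝓝 y) := by
  have : Nonempty (Fin m) := ⟨l⟩
  have hρ := h.radius_pos
  obtain ⟨k, hk⟩ := Finite.exists_max fun i => |w (x₀ i)| / p (x₀ i)
  set Q := |w (x₀ k)| / p (x₀ k) + 1
  have hQ : 0 < Q := by
    have := hpos k
    positivity
  obtain ⟨i₀, hi₀⟩ := Finite.exists_min fun i => p (x₀ i)
  set p₀ := min (p (x₀ i₀)) (ρ / (1 + Q))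
  have hp₀ : 0 < p₀ := lt_min (hpos i₀) (by positivity)
  have hp₀ρ : (1 + Q) * p₀ ≤ ρ := by
    rw [mul_comm, ← le_div_iff₀ (by positivity)]
    exact min_le_right _ _
  have hinv := h.sector_invariant hx hpw hQ hp₀ρ (fun i => (min_le_left _ _).trans (hi₀ i))
    fun i => by
      rw [← div_le_iff₀ (hpos i)]
      exact (hk i).trans (by simp [Q])
  set N := m * max ρ ‖x₀‖
  have hN (t : ℝ) (ht : t ≥ 0) : ‖x t‖ ≤ N :=
    ArrayState.norm_le_mul (h.norm_le hx (le_max_left _ _)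
      (fun i => (PiLp.norm_apply_le x₀ i).trans (le_max_right _ _)) t ht)
  have hK := isCompact_closedBall (0 : ArrayState m) N
  obtain ⟨S, hS⟩ := hK.exists_bound_of_continuousOn h.locallyLipschitz.continuous.continuousOn
  have hS' (t : ℝ) (ht : t ≥ 0) : ‖X (x t)‖ ≤ S := hS _ (by simpa using hN t ht)
  have hev : ∀ᶠ t in atTop, x t ∈ Metric.closedBall (0 : ArrayState m) N :=
    (eventually_ge_atTop 0).mono fun t ht => by simpa using hN t ht
  have hpc (y : ArrayState m) (hy : MapClusterPt y atTop x) (i : Fin m) : 0 < p (y i) := by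
    have hcl : IsClosed {z : ArrayState m | p₀ ≤ componentFunctional p i z} :=
      isClosed_le continuous_const (componentFunctional p i).continuous
    exact hp₀.trans_le (hcl.mem_of_mapClusterPt hy
      ((eventually_ge_atTop 0).mono fun t ht => (hinv t ht i).1))
  obtain ⟨c, hc⟩ := h.exists_slope hl hx hS' hN (w := w) hp₀ (fun t ht i => (hinv t ht i).1)
    fun t ht i => (hinv t ht i).2
  obtain ⟨c', hc'⟩ := h.exists_slope hl hx hS' hN (w := -w) (Q := Q) hp₀
    (fun t ht i => (hinv t ht i).1) fun t ht i => by simpa using (hinv t ht i).2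
  have hslope (y : ArrayState m) (hy : MapClusterPt y atTop x) (j : Fin m) :
      w (y j) = c * p (y j) := by
    have h1 := (hc y hy).2
    have h2 := (hc' y hy).2
    have h3 := (hc' y hy).1 j
    simp only [neg_apply] at h2 h3
    -- At the root `l` the maximal and minimal slopes are both attained, hence equal.
    have hcc : c' = -c := by
      have : (c + c') * p (y l) = 0 := by linarith
      linarith [(mul_eq_zero.1 this).resolve_right (hpc y hy l).ne']
    rw [hcc] at h3
    exact le_antisymm ((hc y hy).1 j) (by linarith)
  set D := Real.sqrt (1 + c ^ 2)
  have hD : 0 < D := Real.sqrt_pos.2 (by positivity)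
  have hnorm (y : ArrayState m) (hy : MapClusterPt y atTop x) (j : Fin m) :
      ‖y j‖ = D * p (y j) := by
    rw [← sq_eq_sq₀ (norm_nonneg _) (mul_nonneg hD.le (hpc y hy j).le), hpw, hslope y hy j,
      mul_pow D, Real.sq_sqrt (by positivity)]
    ring
  -- At an extremal agent the derivative of `φ` is nonnegative but at most `-a φ`. With `φ = p` and
  -- `φ = -p` this bounds the largest radius above and the smallest radius below by `ρ`.
  have hextr (φ : Plane →L[ℝ] ℝ) : ∃ y, MapClusterPt y atTop x ∧
      ∃ i, (∀ z, MapClusterPt z atTop x → ∀ j, φ (z j) ≤ φ (y i)) ∧ a (y i) * φ (y i) ≤ 0 := by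
    obtain ⟨y, hy, i, hi, hlim⟩ := exists_mapClusterPt_isMax hN φ
    refine ⟨y, hy, i, hi, ?_⟩
    have h0 := hx.le_apply_of_mapClusterPt h.locallyLipschitz.continuous hS'
      (componentFunctional φ i) (L := φ (y i))
      (fun ε hε => (hlim ε hε).mono fun t ht => ht i) hy rfl
    linarith [h0.trans (h.map_apply_le_of_max φ (hi y hy))]
  have hpeq (y : ArrayState m) (hy : MapClusterPt y atTop x) (j : Fin m) : ‖y j‖ = ρ := by
    rw [hnorm y hy]
    refine le_antisymm ?_ ?_
    · obtain ⟨z, hz, i, hi, hzi⟩ := hextr p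
      have hle : ‖z i‖ ≤ ρ := by
        by_contra! hlt
        exact absurd hzi (not_le.2 (mul_pos (h.damping_pos _ hlt) (hpc z hz i)))
      rw [hnorm z hz] at hle
      exact (mul_le_mul_of_nonneg_left (hi y hy j) hD.le).trans hle
    · obtain ⟨z, hz, i, hi, hzi⟩ := hextr (-p)
      have hle : ρ ≤ ‖z i‖ := by
        by_contra! hlt
        have hzi0 : z i ≠ 0 := fun h0 => by simpa [h0] using hpc z hz i
        have := mul_neg_of_neg_of_pos (h.damping_neg _ hzi0 hlt) (hpc z hz i)
        rw [neg_apply] at hzi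
        linarith
      rw [hnorm z hz] at hle
      exact hle.trans (mul_le_mul_of_nonneg_left (by simpa using hi y hy j) hD.le)
  have hcoinc (y z : ArrayState m) (hy : MapClusterPt y atTop x) (hz : MapClusterPt z atTop x)
      (i j : Fin m) : y i = z j := by
    have hpp : p (y i) = p (z j) :=
      mul_left_cancel₀ hD.ne' (by rw [← hnorm y hy, ← hnorm z hz, hpeq y hy, hpeq z hz])
    rw [← sub_eq_zero, ← norm_eq_zero, ← sq_eq_zero_iff, hpw, map_sub, map_sub, hslope y hy,
      hslope z hz, hpp]
    ring
  obtain ⟨y, -, hy⟩ := hK.exists_mapClusterPt_of_frequently hev.frequently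
  refine ⟨y, ⟨hcoinc y y hy hy, hpeq y hy⟩, ?_⟩
  refine hK.tendsto_nhds_of_unique_mapClusterPt hev fun z _ hz => ?_
  ext1 i
  exact hcoinc z y hz hy i i

/-! ### Stability and attractivity of the synchronization set. -/

theorem norm_sub_le_of_near (h : IsRadialArray X ρ a b e) {x₀ : ArrayState m}
    {x : ℝ → ArrayState m} (hx : IsForwardSolution X x₀ x) {p w : Plane →L[ℝ] ℝ}
    (hpw : ∀ v, ‖v‖ ^ 2 = p v ^ 2 + w v ^ 2) {u : Plane} (hpu : p u = ρ) (hwu : w u = 0)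
    {δ : ℝ} (hδ : 0 < δ) (hδρ : δ ≤ ρ / 2) (h0 : ∀ i, ‖x₀ i - u‖ ≤ δ) :
    ∀ t ≥ 0, ∀ i, ‖x t i - u‖ ≤ 5 * δ := by
  have hρ := h.radius_pos
  have hp0 (i : Fin m) : |p (x₀ i) - ρ| ≤ δ := by
    rw [← hpu, ← map_sub]
    exact (abs_le_of_sq_le_sq (by nlinarith [hpw (x₀ i - u), sq_nonneg (w (x₀ i - u))])
      (norm_nonneg _)).trans (h0 i)
  have hw0 (i : Fin m) : |w (x₀ i)| ≤ δ := by
    rw [← sub_zero (w (x₀ i)), ← hwu, ← map_sub]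
    exact (abs_le_of_sq_le_sq (by nlinarith [hpw (x₀ i - u), sq_nonneg (p (x₀ i - u))])
      (norm_nonneg _)).trans (h0 i)
  have hu : ‖u‖ = ρ := by
    rw [← sq_eq_sq₀ (norm_nonneg _) hρ.le, hpw, hpu, hwu]
    ring
  -- Initially `p ≥ ρ/2` and `|w| ≤ δ`, so `|w| ≤ Q p`; also `(1 + Q)(ρ - 2δ) ≤ ρ`, as the sector
  -- lemma needs. The invariant bounds give `|w| ≤ 3δ` and `|p - ρ| ≤ 2δ`, and `3² + 2² ≤ 5²`.
  set Q := 2 * δ / ρ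
  have hQρ : Q * ρ = 2 * δ := div_mul_cancel₀ _ hρ.ne'
  have hQ : 0 < Q := by positivity
  have hinv := h.sector_invariant hx hpw (p₀ := ρ - 2 * δ) hQ (by nlinarith)
    (fun i => by linarith [(abs_le.1 (hp0 i)).1]) fun i => by
      have := (abs_le.1 (hp0 i)).1
      have h1 : Q * (ρ / 2) ≤ Q * p (x₀ i) := mul_le_mul_of_nonneg_left (by linarith) hQ.le
      linarith [hw0 i]
  have hn := h.norm_le hx (R := ρ + δ) (by linarith) fun i => by
    have := norm_sub_norm_le (x₀ i) u
    linarith [h0 i]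
  intro t ht i
  obtain ⟨h1, h2⟩ := hinv t ht i
  have h3 : p (x t i) ≤ ρ + δ := by
    refine (le_abs_self _).trans ((abs_le_of_sq_le_sq ?_ (norm_nonneg _)).trans (hn t ht i))
    nlinarith [hpw (x t i), sq_nonneg (w (x t i))]
  have h4 : |w (x t i)| ≤ 3 * δ := by
    have : Q * p (x t i) ≤ Q * (ρ + ρ / 2) := mul_le_mul_of_nonneg_left (by linarith) hQ.le
    linarith
  have h5 : |p (x t i) - ρ| ≤ 2 * δ := abs_le.2 ⟨by linarith, by linarith⟩
  refine abs_le_of_sq_le_sq' ?_ (by positivity) |>.2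
  rw [hpw, map_sub, map_sub, hpu, hwu, sub_zero]
  have h6 := sq_le_sq' (abs_le.1 h4).1 (abs_le.1 h4).2
  have h7 := sq_le_sq' (abs_le.1 h5).1 (abs_le.1 h5).2
  nlinarith

end IsRadialArray

theorem Plane.exists_frame {u : Plane} (hu : ‖u‖ = 1) :
    ∃ p w : Plane →L[ℝ] ℝ, (∀ v, ‖v‖ ^ 2 = p v ^ 2 + w v ^ 2) ∧ (∀ v, p v = inner ℝ u v) ∧
      w u = 0 := by
  refine ⟨innerSL ℝ u, innerSL ℝ !₂[-u 1, u 0], fun v => ?_, fun v => rfl, ?_⟩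
  · have h1 : u 0 ^ 2 + u 1 ^ 2 = 1 := by rw [← Plane.norm_sq, hu, one_pow]
    rw [Plane.norm_sq]
    simp only [innerSL_apply_apply, PiLp.inner_apply, Fin.sum_univ_two, RCLike.inner_apply,
      conj_trivial, Matrix.cons_val_zero, Matrix.cons_val_one]
    linear_combination (-(v 0 ^ 2) - v 1 ^ 2) * h1
  · simp only [innerSL_apply_apply, PiLp.inner_apply, Fin.sum_univ_two, RCLike.inner_apply,
      conj_trivial, Matrix.cons_val_zero, Matrix.cons_val_one]
    ring

/-- A functional strictly separating the origin from the compact hull is positive on all agents; its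
normalized Riesz vector is the first axis of the frame. -/
theorem Plane.exists_frame_of_zero_notMem_convexHull {ι : Type*} [Finite ι] [Nonempty ι]
    {η : ι → Plane} (h : (0 : Plane) ∉ convexHull ℝ (range η)) :
    ∃ p w : Plane →L[ℝ] ℝ, (∀ v, ‖v‖ ^ 2 = p v ^ 2 + w v ^ 2) ∧ ∀ i, 0 < p (η i) := by
  obtain ⟨g, r, hg0, hg⟩ := geometric_hahn_banach_point_closed (convex_convexHull ℝ _)
    ((finite_range η).isClosed_convexHull ℝ) h
  rw [map_zero] at hg0
  have hpos (i : ι) : 0 < g (η i) := hg0.trans (hg _ (subset_convexHull ℝ _ (mem_range_self i)))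
  set u := (InnerProductSpace.toDual ℝ Plane).symm g
  have hgu (v : Plane) : inner ℝ u v = g v := InnerProductSpace.toDual_symm_apply
  have hu : u ≠ 0 := fun h0 => by
    obtain ⟨i⟩ := ‹Nonempty ι›
    have := hpos i
    rw [← hgu, h0, inner_zero_left] at this
    exact lt_irrefl _ this
  obtain ⟨p, w, hpw, hp, -⟩ := Plane.exists_frame (u := ‖u‖⁻¹ • u) (norm_smul_inv_norm hu)
  refine ⟨p, w, hpw, fun i => ?_⟩
  rw [hp, real_inner_smul_left, hgu]
  exact mul_pos (inv_pos.2 (norm_pos_iff.2 hu)) (hpos i)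

theorem exists_mem_syncSet {m : ℕ} {ρ : ℝ} (hρ : 0 ≤ ρ) : ∃ η, η ∈ syncSet m ρ := by
  obtain ⟨v, hv⟩ := exists_norm_eq Plane hρ
  exact ⟨WithLp.toLp 2 fun _ => v, fun _ _ => rfl, fun _ => hv⟩

namespace IsRadialArray

variable {m : ℕ} {X : ArrayState m → ArrayState m} {ρ : ℝ} {a : Plane → ℝ}
  {b : Fin m → Fin m → Plane → ℝ} {e : Fin m → Fin m → Prop}

theorem exists_frame_of_infDist_lt (h : IsRadialArray X ρ a b e) (l : Fin m) {x₀ : ArrayState m}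
    {δ : ℝ} (hx₀ : Metric.infDist x₀ (syncSet m ρ) < δ) :
    ∃ y ∈ syncSet m ρ, (∀ i, ‖x₀ i - y i‖ < δ) ∧ ∃ p w : Plane →L[ℝ] ℝ,
      (∀ v, ‖v‖ ^ 2 = p v ^ 2 + w v ^ 2) ∧ (∀ i, p (y i) = ρ ∧ w (y i) = 0) ∧
      ∀ v, |p v| ≤ ‖v‖ := by
  obtain ⟨y, hy, hdist⟩ := (Metric.infDist_lt_iff (exists_mem_syncSet h.radius_pos.le)).1 hx₀
  have hρ := h.radius_pos
  obtain ⟨p, w, hpw, hp, hw⟩ := Plane.exists_frame (u := ρ⁻¹ • y l) (by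
    rw [norm_smul, hy.2 l, Real.norm_of_nonneg (inv_nonneg.2 hρ.le), inv_mul_cancel₀ hρ.ne'])
  refine ⟨y, hy, fun i => ?_, p, w, hpw, fun i => ⟨?_, ?_⟩, fun v => ?_⟩
  · rw [dist_eq_norm] at hdist
    exact (PiLp.norm_apply_le (x₀ - y) i).trans_lt hdist
  · rw [hp, hy.1 i l, real_inner_smul_left, real_inner_self_eq_norm_sq, hy.2 l]
    field_simp
  · rw [hy.1 i l]
    rw [map_smul, smul_eq_mul] at hw
    exact (mul_eq_zero.1 hw).resolve_left (inv_ne_zero hρ.ne')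
  · exact abs_le_of_sq_le_sq (by nlinarith [hpw v, sq_nonneg (w v)]) (norm_nonneg _)

theorem isStableSet (h : IsRadialArray X ρ a b e) (l : Fin m) :
    IsStableSet X (syncSet m ρ) := by
  have hρ := h.radius_pos
  have hm : (0 : ℝ) < m := by exact_mod_cast l.pos
  intro ε hε
  set δ := min (ρ / 2) (ε / (5 * m))
  have hδ : 0 < δ := lt_min (by positivity) (by positivity)
  refine ⟨δ / 2, by positivity, fun x₀ hx₀ x hx t ht => ?_⟩
  obtain ⟨y, hy, hnear, p, w, hpw, hpy, -⟩ :=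
    h.exists_frame_of_infDist_lt l (hx₀.trans_lt (half_lt_self hδ))
  have hstay := h.norm_sub_le_of_near hx hpw (hpy l).1 (hpy l).2 hδ (min_le_left _ _)
    (fun i => by rw [hy.1 l i]; exact (hnear i).le) t ht
  refine (Metric.infDist_le_dist_of_mem hy).trans ?_
  rw [dist_eq_norm]
  have : ‖x t - y‖ ≤ m * (5 * δ) := ArrayState.norm_le_mul fun i => by
    rw [PiLp.sub_apply, hy.1 i l]
    exact hstay i
  have hδε : δ ≤ ε / (5 * m) := min_le_right _ _
  rw [le_div_iff₀ (by positivity)] at hδε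
  linarith

theorem isLocallyAttractiveSet (h : IsRadialArray X ρ a b e) {l : Fin m}
    (hl : ∀ k, k ≠ l → Relation.TransGen e k l) : IsLocallyAttractiveSet X (syncSet m ρ) := by
  have hρ := h.radius_pos
  -- Within distance `ρ` of a synchronized state, every agent has a positive coordinate along the
  -- common direction, which is all that convergence requires.
  refine ⟨ρ / 2, by positivity, fun x₀ hx₀ => ⟨h.exists_solution x₀, fun x hx => ?_⟩⟩
  obtain ⟨y, hy, hnear, p, w, hpw, hpy, hple⟩ :=
    h.exists_frame_of_infDist_lt l (hx₀.trans_lt (half_lt_self hρ))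
  obtain ⟨z, hz, hlim⟩ := h.exists_tendsto hl hx hpw fun i => by
    have h1 := hple (x₀ i - y i)
    rw [map_sub, (hpy i).1] at h1
    linarith [(abs_le.1 h1).1, hnear i]
  have := ((Metric.continuous_infDist_pt (syncSet m ρ)).tendsto z).comp hlim
  rwa [Metric.infDist_zero_of_mem hz] at this

end IsRadialArray

/-! ### The averaged Liénard array as a radial array. -/

theorem mul_pos_of_isClassK_le {g : ℝ → ℝ} (hg : ∀ s, 0 ≤ s * g s) {α : ℝ≥0 → ℝ≥0}
    (hα : IsClassK α) (h : ∀ s : ℝ, (α ‖s‖₊ : ℝ) ≤ |g s|) {s : ℝ} (hs : s ≠ 0) : 0 < s * g s := by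
  refine (hg s).lt_of_ne' (mul_ne_zero hs (abs_pos.1 (lt_of_lt_of_le ?_ (h s))))
  have : α 0 < α ‖s‖₊ := hα.2.2 (nnnorm_pos.2 hs)
  rw [hα.2.1] at this
  exact_mod_cast this

theorem isRadialArray_avgArray {m : ℕ} {f : ℝ → ℝ} {γ : Fin m → Fin m → ℝ → ℝ}
    (hf : LocallyLipschitz f) (hγl : ∀ i j : Fin m, i ≠ j → LocallyLipschitz (γ i j))
    (hγ : IsInterconnection γ) (heven : Function.Even f) {ρ : ℝ} (hρ : 0 < ρ)
    (hneg : ∀ s ∈ Ioo 0 ρ, lienardKappa f s < 0) (hpos : ∀ s ∈ Ioi ρ, 0 < lienardKappa f s) :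
    IsRadialArray (avgArray f γ) ρ (dampingGain f) (fun i j => couplingGain (γ i j))
      (InterconnectionEdge γ) where
  apply_eq η i := by
    change -avgDamping f (η i) + ∑ j ∈ Finset.univ.erase i, avgCoupling (γ i j) (η j - η i) = _
    rw [← avgDamping_eq_smul hf.continuous]
    congr 1
    refine Finset.sum_congr rfl fun j hj => ?_
    have hij := (Finset.ne_of_mem_erase hj).symm
    exact avgCoupling_eq_smul (hγl i j hij).continuous (hγ i j hij).1.1 _
  locallyLipschitz := locallyLipschitz_avgArray hf hγl
  radius_pos := hρ
  damping_neg v hv hvρ := by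
    rw [dampingGain_eq hf.continuous heven hv]
    exact div_neg_of_neg_of_pos (hneg _ ⟨norm_pos_iff.2 hv, hvρ⟩) (norm_pos_iff.2 hv)
  damping_pos v hvρ := by
    have hv : 0 < ‖v‖ := hρ.trans hvρ
    rw [dampingGain_eq hf.continuous heven (norm_pos_iff.1 hv)]
    exact div_pos (hpos _ hvρ) hv
  -- Boundedness of `f` on `[-ρ, ρ]` handles the disc of radius `ρ`; outside it the gain is
  -- positive.
  damping_lower := by
    obtain ⟨C, hC0, hC⟩ := exists_neg_le_dampingGain hf.continuous ρ
    refine ⟨C, fun v => ?_⟩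
    rcases le_or_gt ‖v‖ ρ with h | h
    · exact hC v h
    · have hv : 0 < ‖v‖ := hρ.trans h
      rw [dampingGain_eq hf.continuous heven (norm_pos_iff.1 hv)]
      exact (neg_nonpos.2 hC0).trans (div_pos (hpos _ h) hv).le
  coupling_nonneg i j hij v := couplingGain_nonneg (hγl i j hij).continuous (hγ i j hij).1.2 v
  coupling_pos i j hij := by
    refine ⟨hij.1, fun v hv => ?_⟩
    obtain ⟨⟨-, hs⟩, hzero | ⟨α, hα, hle⟩⟩ := hγ i j hij.1
    · obtain ⟨s, hs⟩ := hij.2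
      exact absurd (hzero s) hs
    · exact couplingGain_pos (hγl i j hij.1).continuous
        (fun s hs0 => mul_pos_of_isClassK_le hs hα hle hs0) hv

theorem mainTheorem4 {m : ℕ} (f : ℝ → ℝ) (γ : Fin m → Fin m → ℝ → ℝ)
    (hf_lip : LocallyLipschitz f)
    (hγ_lip : ∀ i j : Fin m, i ≠ j → LocallyLipschitz (γ i j))
    (hγ : IsInterconnection γ)
    (hconn : InterconnectionConnected γ)
    (hL1 : Function.Even f)
    (hL2 : LienardL2 (fun s => ∫ σ in (0 : ℝ)..s, f σ)) :
    ∃ ρ : ℝ, 0 < ρ ∧ lienardKappa f ρ = 0 ∧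
      (∀ s : ℝ, 0 < s → lienardKappa f s = 0 → s = ρ) ∧
      IsLocallyAsymptoticallyStableSet (avgArray f γ) (syncSet m ρ) ∧
      ∀ η₀ : ArrayState m, (0 : Plane) ∉ convexHull ℝ (Set.range fun i => η₀ i) →
        (∃ η : ℝ → ArrayState m, IsForwardSolution (avgArray f γ) η₀ η) ∧
        ∀ η : ℝ → ArrayState m, IsForwardSolution (avgArray f γ) η₀ η →
          ∃ ηstar ∈ syncSet m ρ, Tendsto η atTop (𝓝 ηstar) := by
  obtain ⟨ρ, hρ, hκ, hneg, hpos⟩ := exists_sign_change_lienardKappa hf_lip.continuous hL2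
  obtain ⟨l, hl⟩ := hconn
  have : Nonempty (Fin m) := ⟨l⟩
  have h := isRadialArray_avgArray hf_lip hγ_lip hγ hL1 hρ hneg hpos
  refine ⟨ρ, hρ, hκ, fun s hs hκs => ?_, ⟨h.isStableSet l, h.isLocallyAttractiveSet hl⟩,
    fun η₀ hη₀ => ⟨h.exists_solution η₀, fun η hη => ?_⟩⟩
  · rcases lt_trichotomy s ρ with hlt | heq | hgt
    · exact absurd hκs (hneg s ⟨hs, hlt⟩).ne
    · exact heq
    · exact absurd hκs (hpos s hgt).ne'
  · obtain ⟨p, w, hpw, hp⟩ := Plane.exists_frame_of_zero_notMem_convexHull hη₀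
    exact h.exists_tendsto hl hη hpw hp
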